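/- Let $H$ be the plane graph on the vertices $v_1,\dots,v_7$ with the 15 edges $v_2v_3, v_3v_4, v_4v_5, v_5v_7, v_7v_6, v_6v_2$, $v_2v_1, v_1v_5, v_4v_1, v_1v_6, v_7v_1, v_1v_3$, $v_3v_5, v_5v_6, v_6v_3$, drawn with straight edges and with $v_1=(0,0)$, $v_2=(0,-1)$, $v_3=(3,0)$, $v_4=(1,1)$, $v_5=(0,3)$, $v_6=(-3,-3)$, $v_7=(-1,0)$. (Its edges join consecutive points on the lines $234$, $457$, $762$, $215$, $416$, $713$ and on the closed line $356$ of the Fano plane.) The cells of $H$ are $\emptyset$, its vertices, edges and faces, and $H$ itself, of dimension $-1,0,1,2,3$; $L(H)$ is the set of cells ordered by inclusion. The dual graph of $H$ has the faces of $H$ as its vertices, two of them being adjacent if they share an edge on their boundaries. A rhombic strip of a graded poset is a spanning subgraph of its cover graph, drawn on the cylinder $\mathbb{R}^2/((x,y)\sim(x+1,y))$ such that the height of each element is its rank, edges are straight lines that do not cross, and every face of the drawing is bounded by a 4-cycle $(a,b,c,d)$ in which $a,c$ have the same rank $r$ and $b,d$ have ranks $r-1$ and $r+1$. For a Hamiltonian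 cycle $C$ of $H$, a $C$-chord is an edge of $H$ not on $C$. The chord condition on $C$ is: for no labelling $C=(w_1,\dots,w_7)$ of the cycle in cyclic order, with $w_8=w_1$, are there three $C$-chords $(w_{i_1},w_{i_2}),(w_{i_3},w_{i_4}),(w_{i_5},w_{i_6})$ with $1\le i_1<i_2\le i_3<i_4\le i_5<i_6\le 8$. Then $H$ is a 3-connected plane graph, $H$ and its dual graph both have a Hamiltonian cycle, and $L(H)$ is graded by dimension, but the cover graph of $L(H)$ has no rhombic strip. Moreover, up to automorphisms of $H$, the graph $H$ has exactly two Hamiltonian cycles, $C_1=(v_1,v_2,v_3,v_4,v_5,v_6,v_7)$ and $C_2=(v_1,v_6,v_2,v_3,v_4,v_5,v_7)$, and both violate the chord condition; hence every Hamiltonian cycle of $H$ violates it. -/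

import Mathlib

/-! ### Graphs -/

/-- `G` has a Hamiltonian cycle. (No convention is made for graphs with fewer than three
vertices: a cycle has length at least three.) -/
def HasHamiltonianCycle {V : Type*} (G : SimpleGraph V) : Prop :=
  open Classical in ∃ (v : V) (C : G.Walk v v), C.IsHamiltonianCycle

/-- `G` is 3-connected: it has more than three vertices, and it stays connected when fewer than
three vertices are deleted. -/
def ThreeConnected {V : Type*} (G : SimpleGraph V) : Prop :=
  3 < Nat.card V ∧ ∀ S : Set V, S.encard < 3 → (G.induce Sᶜ).Connected

/-- The edge `(x, y)` is a `C`-chord: an edge of `G` that does not lie on `C`. -/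
def IsChord {V : Type*} {G : SimpleGraph V} {v : V} (C : G.Walk v v) (x y : V) : Prop :=
  G.Adj x y ∧ s(x, y) ∉ C.edges

/-- Write the closed walk `C` of length `n` as `(v_1, …, v_n)` and put `v_{n+1} = v_1`, so that
`v_{j+1} = C.getVert j` for `j = 0, …, n`. There are three `C`-chords
`(v_{i₁}, v_{i₂}), (v_{i₃}, v_{i₄}), (v_{i₅}, v_{i₆})` with
`1 ≤ i₁ < i₂ ≤ i₃ < i₄ ≤ i₅ < i₆ ≤ n + 1`. (The indices below are smaller by one.) -/
def HasThreeSeparatedChords {V : Type*} {G : SimpleGraph V} {v : V} (C : G.Walk v v) : Prop :=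
  ∃ i₁ i₂ i₃ i₄ i₅ i₆ : ℕ,
    i₁ < i₂ ∧ i₂ ≤ i₃ ∧ i₃ < i₄ ∧ i₄ ≤ i₅ ∧ i₅ < i₆ ∧ i₆ ≤ C.length ∧
    IsChord C (C.getVert i₁) (C.getVert i₂) ∧
    IsChord C (C.getVert i₃) (C.getVert i₄) ∧
    IsChord C (C.getVert i₅) (C.getVert i₆)

/-- The chord condition on a Hamiltonian cycle, as a condition on the cyclic sequence of its
vertices: whichever vertex of `C` is called `v_1`, there are no three `C`-chords as above.
(Reversing `C` merely reverses the order of the indices.) -/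
def ChordCondition {V : Type*} [DecidableEq V] {G : SimpleGraph V} {v : V}
    (C : G.Walk v v) : Prop :=
  ∀ (u : V) (hu : u ∈ C.support), ¬ HasThreeSeparatedChords (C.rotate u hu)

/-- Two cycles of `G` are equal up to symmetry: some automorphism of `G` maps the edge set of one
onto the edge set of the other. -/
def EquivCycles {V : Type*} {G : SimpleGraph V} {u v : V} (C : G.Walk u u) (D : G.Walk v v) :
    Prop :=
  ∃ φ : G ≃g G, Sym2.map φ '' {e | e ∈ C.edges} = {e | e ∈ D.edges}

/-! ### Straight-line plane graphs, their cells, and their dual graphs -/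

/-- A finite graph drawn in the plane with edges drawn as straight line segments.
It is a plane graph if `IsPlane` below holds. -/
structure StraightLineGraph (V : Type*) where
  graph : SimpleGraph V
  pos : V → ℝ × ℝ

namespace StraightLineGraph

variable {V : Type*} (H : StraightLineGraph V)

/-- The segment that represents an edge, including its endpoints. -/
def edgeSegment (e : Sym2 V) : Set (ℝ × ℝ) := convexHull ℝ (H.pos '' {v | v ∈ e})

/-- The drawing is a plane graph: vertices are distinct points, a vertex lies on an edge only as
one of its endpoints, and distinct edges meet at most in common endpoints. -/
def IsPlane : Prop :=
  Function.Injective H.pos ∧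
  (∀ e ∈ H.graph.edgeSet, ∀ v : V, H.pos v ∈ H.edgeSegment e → v ∈ e) ∧
  (∀ e ∈ H.graph.edgeSet, ∀ e' ∈ H.graph.edgeSet, e ≠ e' →
    ∀ p ∈ H.edgeSegment e ∩ H.edgeSegment e', ∃ v : V, v ∈ e ∧ v ∈ e' ∧ p = H.pos v)

/-- The point set of the drawing. -/
def drawing : Set (ℝ × ℝ) := Set.range H.pos ∪ ⋃ e ∈ H.graph.edgeSet, H.edgeSegment e

/-- The (open) faces: the connected components of the complement of the drawing. -/
def faces : Set (Set (ℝ × ℝ)) :=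
  {F | ∃ p ∈ H.drawingᶜ, F = connectedComponentIn H.drawingᶜ p}

/-- The dual graph: its vertices are the faces, and two distinct faces are adjacent if some edge
lies on the boundary of both. -/
def dual : SimpleGraph H.faces where
  Adj F F' := F ≠ F' ∧ ∃ e ∈ H.graph.edgeSet,
    H.edgeSegment e ⊆ frontier (F : Set (ℝ × ℝ)) ∧ H.edgeSegment e ⊆ frontier (F' : Set (ℝ × ℝ))
  symm := ⟨fun _ _ h => ⟨h.1.symm, h.2.imp fun _ he => ⟨he.1, he.2.2, he.2.1⟩⟩⟩
  loopless := ⟨fun _ h => h.1 rfl⟩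

/-- The cells: the vertices, edges and faces, and the two trivial cells, the empty set and the
whole plane graph. -/
inductive Cell : Type _
  | empty : Cell
  | vertex (v : V) : Cell
  | edge (e : H.graph.edgeSet) : Cell
  | face (F : H.faces) : Cell
  | whole : Cell

variable {H}

/-- The closed point set of a cell. -/
def Cell.carrier : H.Cell → Set (ℝ × ℝ)
  | .empty => ∅
  | .vertex v => {H.pos v}
  | .edge e => H.edgeSegment e
  | .face F => closure (F : Set (ℝ × ℝ))
  | .whole => Set.univ

/-- The dimension of a cell. -/
def Cell.dim : H.Cell → ℤ
  | .empty => -1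
  | .vertex _ => 0
  | .edge _ => 1
  | .face _ => 2
  | .whole => 3

/-- The inclusion order `L(H)` of the cells. Distinct comparable cells have distinct dimensions. -/
instance : PartialOrder H.Cell where
  le x y := x = y ∨ (x.dim < y.dim ∧ x.carrier ⊆ y.carrier)
  le_refl _ := Or.inl rfl
  le_trans := by
    rintro x y z (rfl | hxy) (rfl | hyz)
    · exact Or.inl rfl
    · exact Or.inr hyz
    · exact Or.inr hxy
    · exact Or.inr ⟨hxy.1.trans hyz.1, hxy.2.trans hyz.2⟩
  le_antisymm := by
    rintro x y (rfl | hxy) (h | hyx)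
    · rfl
    · rfl
    · exact h.symm
    · exact absurd hxy.1 hyx.1.asymm

end StraightLineGraph

/-! ### Rhombic strips -/

/-- `rk` is a rank function of the poset `P`. -/
def IsRankFunction {P : Type*} [PartialOrder P] (rk : P → ℤ) : Prop :=
  ∀ x y : P, x ⋖ y → rk y = rk x + 1

/-- The quotient map from the plane to the cylinder, the quotient of the plane by
`(x, y) ∼ (x + 1, y)`. -/
def toCylinder (p : ℝ × ℝ) : UnitAddCircle × ℝ := ((p.1 : UnitAddCircle), p.2)

/-- A straight-line drawing, on the cylinder, of a graph `R` whose vertices have the prescribed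
heights `rk`. A vertex `v` is the image of the point `(x v, rk v)` of the plane, and an edge `(u, v)`
is the image of the straight line segment from `(x u, rk u)` to `(x v + k, rk v)`, with an integer
`k = wind u v` that says how the edge winds around the cylinder. -/
structure CylinderDrawing {P : Type*} (R : SimpleGraph P) (rk : P → ℤ) where
  x : P → ℝ
  wind : P → P → ℤ
  wind_swap : ∀ u v, wind v u = -wind u v

namespace CylinderDrawing

variable {P : Type*} {R : SimpleGraph P} {rk : P → ℤ} (D : CylinderDrawing R rk)

/-- The point of the cylinder that represents a vertex. -/
def point (v : P) : UnitAddCircle × ℝ := toCylinder (D.x v, rk v)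

/-- The straight line on the cylinder that represents an edge `(u, v)`. -/
def arc (u v : P) : Set (UnitAddCircle × ℝ) :=
  toCylinder '' segment ℝ ((D.x u, (rk u : ℝ)) : ℝ × ℝ) (D.x v + D.wind u v, (rk v : ℝ))

/-- Distinct vertices are distinct points, and distinct edges meet only in common endpoints. -/
def NoCrossing : Prop :=
  Function.Injective D.point ∧
  ∀ u v u' v', R.Adj u v → R.Adj u' v' → s(u, v) ≠ s(u', v') →
    ∀ p ∈ D.arc u v ∩ D.arc u' v', ∃ w, w ∈ s(u, v) ∧ w ∈ s(u', v') ∧ p = D.point w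

/-- The point set of the drawing. -/
def drawing : Set (UnitAddCircle × ℝ) :=
  Set.range D.point ∪ ⋃ (u : P) (v : P) (_ : R.Adj u v), D.arc u v

/-- The set `F` is bounded by a rhombus: its boundary is a 4-cycle `(a, b, c, d)` of `R` in which
`a` and `c` have the same rank `r`, while `b` and `d` have the ranks `r - 1` and `r + 1`. -/
def IsRhombus (F : Set (UnitAddCircle × ℝ)) : Prop :=
  ∃ a b c d : P, a ≠ c ∧ R.Adj a b ∧ R.Adj b c ∧ R.Adj c d ∧ R.Adj d a ∧
    rk c = rk a ∧ rk b = rk a - 1 ∧ rk d = rk a + 1 ∧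
    frontier F = D.arc a b ∪ D.arc b c ∪ D.arc c d ∪ D.arc d a

end CylinderDrawing

/-- The cover graph of the poset `P`, graded by the rank function `rk`, has a rhombic strip: a
spanning subgraph `R`, drawn on the cylinder with heights given by the ranks, edges drawn as
straight lines without crossings, and every face (connected component of the complement)
bounded by a rhombus. -/
def HasRhombicStrip {P : Type*} [PartialOrder P] (rk : P → ℤ) : Prop :=
  ∃ R : SimpleGraph P, R ≤ SimpleGraph.hasse P ∧
    ∃ D : CylinderDrawing R rk, D.NoCrossing ∧
      ∀ p ∈ D.drawingᶜ, D.IsRhombus (connectedComponentIn D.drawingᶜ p)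

/-! ### The plane graph obtained from the Fano plane -/

/-- The edges of the graph, where `i : Fin 7` stands for the vertex `v_{i+1}`: the points of the
Fano plane with lines `234`, `457`, `762`, `215`, `416`, `713`, `356` are joined consecutively
along each of these lines, where the last line (the circle) is closed. -/
def fanoEdges : List (Fin 7 × Fin 7) :=
  [(1, 2), (2, 3), (3, 4), (4, 6), (6, 5), (5, 1),
   (1, 0), (0, 4), (3, 0), (0, 5), (6, 0), (0, 2),
   (2, 4), (4, 5), (5, 2)]

/-- The plane graph: the outer triangle is `v₃ v₅ v₆`, the vertex `v₁` is in its center and joined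
to all other vertices, and each of `v₄`, `v₇`, `v₂` is inside one of the triangles `v₁ v₃ v₅`,
`v₁ v₅ v₆`, `v₁ v₃ v₆` and joined to its three corners. -/
def fano : StraightLineGraph (Fin 7) where
  graph := SimpleGraph.fromRel fun a b => (a, b) ∈ fanoEdges
  pos := ![(0, 0), (0, -1), (3, 0), (1, 1), (0, 3), (-3, -3), (-1, 0)]

/-! The obstruction to a rhombic strip concerns cyclic orders of the 15 edges of `H`. In a strip
these edges are points of one circle, and at that height the drawing contains nothing but them. The
gap between two neighbors on the circle therefore lies in a single face of the drawing, and the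
rhombus around it gives the two edges a common vertex of `H` below and a common face above
(`exists_rhombus_of_gap`). On the universal cover of the cylinder, arcs from vertices up to edges do
not cross (`IsLift.mono`), so the lifts of the common vertices form a weakly increasing sequence
that gains 1 per period. Hence, cyclically, every vertex occurs in one uninterrupted block. An
exhaustive search shows that no cyclic sequence of all 15 edges has these properties
(`no_cyclic_sequence`). The chord condition plays no role in this argument.

The search needs the incidences between vertices, edges and faces. All coordinates are integers, so
the position of a vertex relative to a line through two others is the sign of an integer
determinant, and it extends to edges because `area` is affine in its last argument. The faces are
nine open triangles and the complement of the closed outer triangle: each of these sets is open,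
connected and disjoint from the drawing, and its closure adds only points of the drawing, so it is a
component (`component_eq_region`).

The Hamiltonian cycles are enumerated from `v₁`. One of six explicit automorphisms takes each of
them to `C₁` or `C₂`, and each has a starting vertex for which the chords `(w₁, w₃)`, `(w₃, w₅)`,
`(w₅, w₇)` exist. -/

/-! ### Orientations and segments -/

/-- First coordinates of the vertices. -/
def fanoX : Fin 7 → ℤ := ![0, 0, 3, 1, 0, -3, -1]

/-- Second coordinates of the vertices. -/
def fanoY : Fin 7 → ℤ := ![0, -1, 0, 1, 3, -3, 0]

/-- Twice the signed area of the triangle with vertices `a`, `b`, `c`. -/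
def fanoArea (a b c : Fin 7) : ℤ :=
  (fanoX b - fanoX a) * (fanoY c - fanoY a) - (fanoY b - fanoY a) * (fanoX c - fanoX a)

/-- Twice the signed area of the triangle `a`, `b`, `p`, for a point `p` of the plane. -/
def area (a b p : ℝ × ℝ) : ℝ := (b.1 - a.1) * (p.2 - a.2) - (b.2 - a.2) * (p.1 - a.1)

theorem fano_pos (v : Fin 7) : fano.pos v = ((fanoX v : ℝ), (fanoY v : ℝ)) := by
  fin_cases v <;> simp [fano, fanoX, fanoY]

theorem area_pos (a b v : Fin 7) :
    area (fano.pos a) (fano.pos b) (fano.pos v) = fanoArea a b v := by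
  simp [area, fanoArea, fano_pos]

theorem area_lineMap (a b p q : ℝ × ℝ) (t : ℝ) :
    area a b (p + t • (q - p)) = (1 - t) * area a b p + t * area a b q := by
  simp [area]; ring

theorem continuous_area (a b : ℝ × ℝ) : Continuous (area a b) := by
  unfold area; fun_prop

theorem edgeSegment_mk {V : Type*} (H : StraightLineGraph V) (a b : V) :
    H.edgeSegment s(a, b) = segment ℝ (H.pos a) (H.pos b) := by
  have : {v | v ∈ s(a, b)} = {a, b} := by ext; simp
  rw [StraightLineGraph.edgeSegment, this, Set.image_pair, convexHull_pair]

theorem mem_segment_iff_exists {p a b : ℝ × ℝ} :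
    p ∈ segment ℝ a b ↔ ∃ t : ℝ, 0 ≤ t ∧ t ≤ 1 ∧ p = a + t • (b - a) := by
  rw [segment_eq_image']
  constructor
  · rintro ⟨t, ⟨h0, h1⟩, rfl⟩; exact ⟨t, h0, h1, rfl⟩
  · rintro ⟨t, h0, h1, rfl⟩; exact ⟨t, ⟨h0, h1⟩, rfl⟩

/-- The closed triangle with the corners `a`, `b`, `c` in counterclockwise order. -/
def closedTri (a b c : ℝ × ℝ) : Set (ℝ × ℝ) := {p | 0 ≤ area a b p ∧ 0 ≤ area b c p ∧ 0 ≤ area c a p}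

/-- The open triangle with the corners `a`, `b`, `c` in counterclockwise order. -/
def openTri (a b c : ℝ × ℝ) : Set (ℝ × ℝ) := {p | 0 < area a b p ∧ 0 < area b c p ∧ 0 < area c a p}

/-- Up to the factor `area a b c`, the areas `area b c p`, `area c a p`, `area a b p` are the
barycentric coordinates of `p` with respect to `a`, `b`, `c`, and the last one vanishes. -/
theorem mem_segment_of_area_eq_zero {a b c p : ℝ × ℝ} (h : 0 < area a b c)
    (h0 : area a b p = 0) (h1 : 0 ≤ area b c p) (h2 : 0 ≤ area c a p) : p ∈ segment ℝ a b := by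
  have hs : area b c p + area c a p = area a b c := by
    have : area a b p + area b c p + area c a p = area a b c := by simp only [area]; ring
    linarith
  have e1 : area a b c * p.1 = area b c p * a.1 + area c a p * b.1 + area a b p * c.1 := by
    simp only [area]; ring
  have e2 : area a b c * p.2 = area b c p * a.2 + area c a p * b.2 + area a b p * c.2 := by
    simp only [area]; ring
  rw [h0] at e1 e2
  rw [mem_segment_iff_exists]
  refine ⟨area c a p / area a b c, by positivity, ?_, ?_⟩
  · rw [div_le_one h]; linarith
  · ext
    · simp only [Prod.fst_add, Prod.smul_fst, Prod.fst_sub, smul_eq_mul]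
      field_simp
      linear_combination e1 + a.1 * hs
    · simp only [Prod.snd_add, Prod.smul_snd, Prod.snd_sub, smul_eq_mul]
      field_simp
      linear_combination e2 + a.2 * hs

theorem area_rotate (a b c : ℝ × ℝ) : area b c a = area a b c := by
  simp only [area]; ring

theorem closedTri_subset {a b c : ℝ × ℝ} (h : 0 < area a b c) :
    closedTri a b c ⊆ openTri a b c ∪ (segment ℝ a b ∪ segment ℝ b c ∪ segment ℝ c a) := by
  rintro p ⟨h0, h1, h2⟩
  rcases h0.eq_or_lt with e0 | l0
  · exact Or.inr (Or.inl (Or.inl (mem_segment_of_area_eq_zero h e0.symm h1 h2)))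
  rcases h1.eq_or_lt with e1 | l1
  · exact Or.inr (Or.inl (Or.inr
      (mem_segment_of_area_eq_zero (by rwa [area_rotate]) e1.symm h2 h0)))
  rcases h2.eq_or_lt with e2 | l2
  · exact Or.inr (Or.inr
      (mem_segment_of_area_eq_zero (by rwa [← area_rotate]) e2.symm h0 h1))
  · exact Or.inl ⟨l0, l1, l2⟩

/-- The numbers `area d a p`, `area d b p`, `area d c p` satisfy a linear relation with positive
coefficients (`key`). If `p` were in none of the three parts, either all three would be negative, or
two positive and the third nonnegative. -/
theorem closedTri_split {a b c d p : ℝ × ℝ} (hd : d ∈ openTri a b c) (hp : p ∈ closedTri a b c) :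
    p ∈ closedTri a b d ∨ p ∈ closedTri b c d ∨ p ∈ closedTri c a d := by
  obtain ⟨h0, h1, h2⟩ := hd
  obtain ⟨k0, k1, k2⟩ := hp
  have key : area b c d * area d a p + area c a d * area d b p + area a b d * area d c p = 0 := by
    simp only [area]; ring
  have sw : ∀ x y : ℝ × ℝ, area x y p = - area y x p := by intro x y; simp only [area]; ring
  simp only [closedTri, Set.mem_ofPred_eq, sw b d, sw c d, sw a d]
  by_contra! hcon
  obtain ⟨c1, c2, c3⟩ := hcon
  by_cases hx : 0 ≤ area d a p
  · have hy : 0 < area d b p := by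
      by_contra! hy
      have := c1 k0 (by linarith); linarith
    have hz : 0 < area d c p := by
      by_contra! hz
      have := c2 k1 (by linarith); linarith
    nlinarith [mul_nonneg h1.le hx, mul_pos h2 hy, mul_pos h0 hz]
  · push Not at hx
    have hz : area d c p < 0 := by
      by_contra! hz
      have := c3 k2 (by linarith); linarith
    have hy : area d b p < 0 := by
      by_contra! hy
      have := c2 k1 (by linarith); linarith
    nlinarith [mul_pos h1 (neg_pos.2 hx), mul_pos h2 (neg_pos.2 hy), mul_pos h0 (neg_pos.2 hz)]

theorem mem_closure_of_ray {S : Set (ℝ × ℝ)} {p c : ℝ × ℝ}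
    (h : ∀ t : ℝ, 0 < t → t ≤ 1 → p + t • (c - p) ∈ S) : p ∈ closure S := by
  have hc : Filter.Tendsto (fun t : ℝ => p + t • (c - p)) (nhdsWithin 0 (Set.Ioi 0)) (nhds p) := by
    have : Continuous (fun t : ℝ => p + t • (c - p)) := by fun_prop
    simpa using (this.tendsto 0).mono_left nhdsWithin_le_nhds
  refine mem_closure_of_tendsto hc ?_
  filter_upwards [Ioc_mem_nhdsGT (zero_lt_one' ℝ)] with t ht using h t ht.1 ht.2

theorem isClosed_closedTri (a b c : ℝ × ℝ) : IsClosed (closedTri a b c) :=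
  (isClosed_le continuous_const (continuous_area a b)).inter
    ((isClosed_le continuous_const (continuous_area b c)).inter
      (isClosed_le continuous_const (continuous_area c a)))

theorem isOpen_openTri (a b c : ℝ × ℝ) : IsOpen (openTri a b c) :=
  (isOpen_lt continuous_const (continuous_area a b)).inter
    ((isOpen_lt continuous_const (continuous_area b c)).inter
      (isOpen_lt continuous_const (continuous_area c a)))

theorem openTri_subset_closedTri (a b c : ℝ × ℝ) : openTri a b c ⊆ closedTri a b c :=
  fun _ h => ⟨h.1.le, h.2.1.le, h.2.2.le⟩

theorem closure_openTri {a b c : ℝ × ℝ} (h : 0 < area a b c) :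
    closure (openTri a b c) = closedTri a b c := by
  apply subset_antisymm
  · exact closure_minimal (openTri_subset_closedTri a b c) (isClosed_closedTri a b c)
  · rintro p ⟨h0, h1, h2⟩
    have hc : ∀ a b c : ℝ × ℝ, area a b ((1 / 3 : ℝ) • (a + b + c)) = area a b c / 3 := by
      intro a b c; simp [area]; ring
    apply mem_closure_of_ray (c := (1 / 3 : ℝ) • (a + b + c))
    intro t ht ht1
    refine ⟨?_, ?_, ?_⟩ <;> rw [area_lineMap]
    · rw [hc]; have : 0 < t * (area a b c / 3) := by positivity
      nlinarith
    · rw [show a + b + c = b + c + a by abel, hc, area_rotate a b c]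
      have : 0 < t * (area a b c / 3) := by positivity
      nlinarith
    · rw [show a + b + c = c + a + b by abel, hc, ← area_rotate c a b]
      have : 0 < t * (area a b c / 3) := by positivity
      nlinarith

theorem isPreconnected_halfPlane (a b : ℝ × ℝ) : IsPreconnected {p | area a b p < 0} := by
  refine Convex.isPreconnected fun p hp q hq s t hs ht hst => ?_
  obtain rfl : s = 1 - t := by linarith
  have e : (1 - t) • p + t • q = p + t • (q - p) := by module
  simp only [Set.mem_ofPred_eq] at *
  rw [e, area_lineMap]
  rcases hs.eq_or_lt with h | h
  · nlinarith
  · nlinarith [mul_pos_of_neg_of_neg (neg_lt_zero.2 h) hp]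

theorem convex_openTri (a b c : ℝ × ℝ) : Convex ℝ (openTri a b c) := by
  have H : ∀ a b : ℝ × ℝ, Convex ℝ {p | 0 < area a b p} := by
    intro a b p hp q hq s t hs ht hst
    obtain rfl : s = 1 - t := by linarith
    have e : (1 - t) • p + t • q = p + t • (q - p) := by module
    simp only [Set.mem_ofPred_eq] at *
    rw [e, area_lineMap]
    rcases hs.eq_or_lt with h | h
    · nlinarith
    · nlinarith [mul_pos h hp]
  exact (H a b).inter ((H b c).inter (H c a))

theorem closure_halfPlane {a b : ℝ × ℝ} (h : a ≠ b) {p : ℝ × ℝ} (hp : area a b p ≤ 0) :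
    p ∈ closure {q | area a b q < 0} := by
  -- This is the normal of the line `a b` that points to the side where `area a b` is negative.
  apply mem_closure_of_ray (c := p + (b.2 - a.2, -(b.1 - a.1)))
  intro t ht _
  have hpos : 0 < (b.1 - a.1) ^ 2 + (b.2 - a.2) ^ 2 := by
    by_contra! hc
    apply h
    ext <;> nlinarith [sq_nonneg (b.1 - a.1), sq_nonneg (b.2 - a.2)]
  have e : area a b (p + t • (p + (b.2 - a.2, -(b.1 - a.1)) - p)) =
      area a b p - t * ((b.1 - a.1) ^ 2 + (b.2 - a.2) ^ 2) := by
    simp [area]; ring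
  simp only [Set.mem_ofPred_eq, e]
  have := mul_pos ht hpos
  linarith

/-- The complement of a closed triangle is the union of three half planes. -/
theorem compl_closedTri (a b c : ℝ × ℝ) : (closedTri a b c)ᶜ =
    {p | area a b p < 0} ∪ {p | area b c p < 0} ∪ {p | area c a p < 0} := by
  ext p
  simp only [closedTri, Set.mem_compl_iff, Set.mem_ofPred_eq, Set.mem_union, not_and_or, not_le,
    or_assoc]

theorem closure_compl_closedTri {a b c : ℝ × ℝ} (hab : a ≠ b) (hbc : b ≠ c) (hca : c ≠ a) :
    closure (closedTri a b c)ᶜ = (openTri a b c)ᶜ := by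
  apply subset_antisymm
  · exact closure_minimal (Set.compl_subset_compl.2 (openTri_subset_closedTri a b c))
      (isOpen_openTri a b c).isClosed_compl
  · intro p hp
    rw [compl_closedTri, closure_union, closure_union]
    simp only [openTri, Set.mem_compl_iff, Set.mem_ofPred_eq, not_and_or, not_lt] at hp
    rcases hp with h | h | h
    · exact Or.inl (Or.inl (closure_halfPlane hab h))
    · exact Or.inl (Or.inr (closure_halfPlane hbc h))
    · exact Or.inr (closure_halfPlane hca h)

/-- The half planes beyond two sides overlap behind their common corner: the midpoint of the third
side, reflected in that corner, lies in both. -/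
theorem isPreconnected_compl_closedTri {a b c : ℝ × ℝ} (h : 0 < area a b c) :
    IsPreconnected (closedTri a b c)ᶜ := by
  have hb : ∀ {a b c : ℝ × ℝ}, 0 < area a b c →
      ({p | area a b p < 0} ∩ {p | area b c p < 0}).Nonempty := by
    intro a b c h
    refine ⟨b + (b - (1 / 2 : ℝ) • (a + c)), ?_, ?_⟩
    · have : area a b (b + (b - (1 / 2 : ℝ) • (a + c))) = - area a b c / 2 := by
        simp [area]; ring
      simp only [Set.mem_ofPred_eq, this]; linarith
    · have : area b c (b + (b - (1 / 2 : ℝ) • (a + c))) = - area a b c / 2 := by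
        simp [area]; ring
      simp only [Set.mem_ofPred_eq, this]; linarith
  rw [compl_closedTri]
  refine IsPreconnected.union' ?_ (IsPreconnected.union' (hb h) (isPreconnected_halfPlane a b)
    (isPreconnected_halfPlane b c)) (isPreconnected_halfPlane c a)
  exact (hb (a := b) (b := c) (c := a) (by rwa [area_rotate])).mono
    (Set.inter_subset_inter_left _ Set.subset_union_right)

/-! ### The faces of the plane graph -/

/-- The first endpoint of the `i`-th edge. -/
def edgeFst : Fin 15 → Fin 7 := ![1, 2, 3, 4, 6, 5, 1, 0, 3, 0, 6, 0, 2, 4, 5]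

/-- The second endpoint of the `i`-th edge. -/
def edgeSnd : Fin 15 → Fin 7 := ![2, 3, 4, 6, 5, 1, 0, 4, 0, 5, 0, 2, 4, 5, 2]

/-- The `i`-th edge. -/
def fanoEdge (i : Fin 15) : Sym2 (Fin 7) := s(edgeFst i, edgeSnd i)

theorem fano_adj_iff (a b : Fin 7) : fano.graph.Adj a b ↔ ∃ i, fanoEdge i = s(a, b) := by
  have : fano.graph.Adj a b ↔ a ≠ b ∧ ((a, b) ∈ fanoEdges ∨ (b, a) ∈ fanoEdges) := by
    simp [fano]
  rw [this]
  clear this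
  revert a b
  decide +kernel

instance : DecidableRel fano.graph.Adj := fun a b => decidable_of_iff _ (fano_adj_iff a b).symm

theorem mem_edgeSet_iff (e : Sym2 (Fin 7)) : e ∈ fano.graph.edgeSet ↔ ∃ i, fanoEdge i = e := by
  induction e with | _ a b => exact fano_adj_iff a b

theorem fanoEdge_mem (i : Fin 15) : fanoEdge i ∈ fano.graph.edgeSet :=
  (mem_edgeSet_iff _).2 ⟨i, rfl⟩

theorem fanoEdge_injective : Function.Injective fanoEdge := by
  have : ∀ i j, fanoEdge i = fanoEdge j → i = j := by decide +kernel
  exact this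

/-- The corners of the nine inner faces, and finally of the outer triangle, all of them in
counterclockwise order. -/
def triangle : Fin 10 → Fin 3 → Fin 7 :=
  ![![0, 2, 3], ![2, 4, 3], ![4, 0, 3], ![0, 4, 6], ![4, 5, 6], ![5, 0, 6], ![5, 2, 1],
    ![2, 0, 1], ![0, 5, 1], ![2, 4, 5]]

/-- The open triangle whose corners are given by `triangle`. -/
def openTriangle (i : Fin 10) : Set (ℝ × ℝ) :=
  openTri (fano.pos (triangle i 0)) (fano.pos (triangle i 1)) (fano.pos (triangle i 2))

/-- The closed triangle whose corners are given by `triangle`. -/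
def closedTriangle (i : Fin 10) : Set (ℝ × ℝ) :=
  closedTri (fano.pos (triangle i 0)) (fano.pos (triangle i 1)) (fano.pos (triangle i 2))

/-- The faces. -/
def region (i : Fin 10) : Set (ℝ × ℝ) := if i = 9 then (closedTriangle 9)ᶜ else openTriangle i

/-- The closures of the faces. -/
def closedRegion (i : Fin 10) : Set (ℝ × ℝ) :=
  if i = 9 then (openTriangle 9)ᶜ else closedTriangle i

theorem area_triangle_pos (i : Fin 10) :
    0 < area (fano.pos (triangle i 0)) (fano.pos (triangle i 1)) (fano.pos (triangle i 2)) := by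
  rw [area_pos, Int.cast_pos]; revert i; decide +kernel

theorem fano_pos_injective : Function.Injective fano.pos := by
  intro a b h
  rw [fano_pos, fano_pos, Prod.mk.injEq, Int.cast_inj, Int.cast_inj] at h
  revert a b; decide +kernel

theorem closure_region (i : Fin 10) : closure (region i) = closedRegion i := by
  unfold region closedRegion
  split_ifs with h
  · have : ∀ a b : Fin 7, a ≠ b → fano.pos a ≠ fano.pos b := fun a b h => fano_pos_injective.ne h
    exact closure_compl_closedTri (this _ _ (by decide)) (this _ _ (by decide))
      (this _ _ (by decide))
  · exact closure_openTri (area_triangle_pos i)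

theorem isOpen_region (i : Fin 10) : IsOpen (region i) := by
  unfold region
  split_ifs with h
  · exact (isClosed_closedTri _ _ _).isOpen_compl
  · exact isOpen_openTri _ _ _

theorem isPreconnected_region (i : Fin 10) : IsPreconnected (region i) := by
  unfold region
  split_ifs with h
  · exact isPreconnected_compl_closedTri (area_triangle_pos 9)
  · exact (convex_openTri _ _ _).isPreconnected

theorem drawing_eq : fano.drawing = ⋃ i, segment ℝ (fano.pos (edgeFst i)) (fano.pos (edgeSnd i)) := by
  ext p
  simp only [StraightLineGraph.drawing, Set.mem_union, Set.mem_range, Set.mem_iUnion]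
  constructor
  · rintro (⟨v, rfl⟩ | ⟨e, he, hp⟩)
    · have : ∀ v, ∃ i, edgeFst i = v ∨ edgeSnd i = v := by decide +kernel
      obtain ⟨i, rfl | rfl⟩ := this v
      · exact ⟨i, left_mem_segment _ _ _⟩
      · exact ⟨i, right_mem_segment _ _ _⟩
    · obtain ⟨i, rfl⟩ := (mem_edgeSet_iff e).1 he
      exact ⟨i, by rwa [fanoEdge, edgeSegment_mk] at hp⟩
  · rintro ⟨i, hp⟩
    exact Or.inr ⟨fanoEdge i, fanoEdge_mem i, by rwa [fanoEdge, edgeSegment_mk]⟩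

theorem area_nonpos_of_mem_segment {a b c d : Fin 7} {p : ℝ × ℝ}
    (hp : p ∈ segment ℝ (fano.pos c) (fano.pos d)) (hc : fanoArea a b c ≤ 0)
    (hd : fanoArea a b d ≤ 0) : area (fano.pos a) (fano.pos b) p ≤ 0 := by
  obtain ⟨t, h0, h1, rfl⟩ := mem_segment_iff_exists.1 hp
  rw [area_lineMap, area_pos, area_pos]
  have hc' : (fanoArea a b c : ℝ) ≤ 0 := by exact_mod_cast hc
  have hd' : (fanoArea a b d : ℝ) ≤ 0 := by exact_mod_cast hd
  nlinarith

theorem area_nonneg_of_mem_segment {a b c d : Fin 7} {p : ℝ × ℝ}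
    (hp : p ∈ segment ℝ (fano.pos c) (fano.pos d)) (hc : 0 ≤ fanoArea a b c)
    (hd : 0 ≤ fanoArea a b d) : 0 ≤ area (fano.pos a) (fano.pos b) p := by
  obtain ⟨t, h0, h1, rfl⟩ := mem_segment_iff_exists.1 hp
  rw [area_lineMap, area_pos, area_pos]
  have hc' : 0 ≤ (fanoArea a b c : ℝ) := by exact_mod_cast hc
  have hd' : 0 ≤ (fanoArea a b d : ℝ) := by exact_mod_cast hd
  nlinarith

/-- Every edge has both endpoints in the closed outer triangle, and for each inner triangle some
side has both endpoints weakly on its outer side. By convexity the same holds for the whole segment.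
-/
theorem disjoint_region_drawing (i : Fin 10) : Disjoint (region i) fano.drawing := by
  rw [Set.disjoint_left, drawing_eq]
  simp only [Set.mem_iUnion, not_exists]
  intro p hp j hj
  unfold region at hp
  split_ifs at hp with h
  · apply hp
    have : ∀ j, ∀ k : Fin 3, 0 ≤ fanoArea (triangle 9 k) (triangle 9 (k + 1)) (edgeFst j) ∧
      0 ≤ fanoArea (triangle 9 k) (triangle 9 (k + 1)) (edgeSnd j) := by decide +kernel
    exact ⟨area_nonneg_of_mem_segment hj (this j 0).1 (this j 0).2,
      area_nonneg_of_mem_segment hj (this j 1).1 (this j 1).2,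
      area_nonneg_of_mem_segment hj (this j 2).1 (this j 2).2⟩
  · have : ∀ i, ¬ i = 9 → ∀ j, ∃ k : Fin 3,
      fanoArea (triangle i k) (triangle i (k + 1)) (edgeFst j) ≤ 0 ∧
      fanoArea (triangle i k) (triangle i (k + 1)) (edgeSnd j) ≤ 0 := by decide +kernel
    obtain ⟨k, h1, h2⟩ := this i h j
    have hk := area_nonpos_of_mem_segment hj h1 h2
    obtain ⟨p0, p1, p2⟩ := hp
    fin_cases k
    · exact absurd hk (not_le.2 p0)
    · exact absurd hk (not_le.2 p1)
    · exact absurd hk (not_le.2 p2)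

theorem closedTriangle_subset (i : Fin 10) : closedTriangle i ⊆ openTriangle i ∪ fano.drawing := by
  refine (closedTri_subset (area_triangle_pos i)).trans (Set.union_subset_union_right _ ?_)
  have key : ∀ k : Fin 3,
      segment ℝ (fano.pos (triangle i k)) (fano.pos (triangle i (k + 1))) ⊆ fano.drawing := by
    intro k
    have : ∀ i, ∀ k : Fin 3, ∃ j, (edgeFst j = triangle i k ∧ edgeSnd j = triangle i (k + 1)) ∨
      (edgeFst j = triangle i (k + 1) ∧ edgeSnd j = triangle i k) := by decide +kernel
    rw [drawing_eq]
    obtain ⟨j, ⟨h1, h2⟩ | ⟨h1, h2⟩⟩ := this i k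
    · rw [← h1, ← h2]
      exact Set.subset_iUnion (fun i => segment ℝ (fano.pos (edgeFst i)) (fano.pos (edgeSnd i))) j
    · rw [← h1, ← h2, segment_symm]
      exact Set.subset_iUnion (fun i => segment ℝ (fano.pos (edgeFst i)) (fano.pos (edgeSnd i))) j
  exact Set.union_subset (Set.union_subset (key 0) (key 1)) (key 2)

theorem closedRegion_subset (i : Fin 10) : closedRegion i ⊆ region i ∪ fano.drawing := by
  intro p hp
  unfold closedRegion at hp
  unfold region
  split_ifs at hp ⊢ with h
  · by_cases hc : p ∈ closedTriangle 9
    · exact Or.inr (((closedTriangle_subset 9) hc).resolve_left hp)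
    · exact Or.inl hc
  · exact closedTriangle_subset i hp

/-- The outer triangle is split at `v₁`, and each of the three parts at the vertex inside it; this
gives exactly the nine inner triangles. -/
theorem compl_drawing_subset : fano.drawingᶜ ⊆ ⋃ i, region i := by
  intro p hp
  have fin : ∀ i, i ≠ 9 → p ∈ closedTriangle i → p ∈ ⋃ i, region i := by
    intro i h hi
    refine Set.mem_iUnion.2 ⟨i, ?_⟩
    rw [region, if_neg h]
    exact (closedTriangle_subset i hi).resolve_right hp
  have inside : ∀ a b c d : Fin 7, (0 < fanoArea a b d ∧ 0 < fanoArea b c d ∧ 0 < fanoArea c a d) →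
      fano.pos d ∈ openTri (fano.pos a) (fano.pos b) (fano.pos c) := by
    intro a b c d h
    refine ⟨?_, ?_, ?_⟩ <;> rw [area_pos, Int.cast_pos]
    exacts [h.1, h.2.1, h.2.2]
  by_cases h9 : p ∈ closedTriangle 9
  · rcases closedTri_split (inside 2 4 5 0 (by decide)) h9 with h | h | h
    · rcases closedTri_split (inside 2 4 0 3 (by decide)) h with h | h | h
      exacts [fin 1 (by decide) h, fin 2 (by decide) h, fin 0 (by decide) h]
    · rcases closedTri_split (inside 4 5 0 6 (by decide)) h with h | h | h
      exacts [fin 4 (by decide) h, fin 5 (by decide) h, fin 3 (by decide) h]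
    · rcases closedTri_split (inside 5 2 0 1 (by decide)) h with h | h | h
      exacts [fin 6 (by decide) h, fin 7 (by decide) h, fin 8 (by decide) h]
  · exact Set.mem_iUnion.2 ⟨9, by rwa [region, if_pos rfl]⟩

/-- A point of the complement of the drawing lies in `region i` or outside its closure. These are
disjoint open sets, so the connected component of `p` cannot leave the first. -/
theorem component_eq_region {i : Fin 10} {p : ℝ × ℝ} (hp : p ∈ region i) :
    connectedComponentIn fano.drawingᶜ p = region i := by
  have hsub : region i ⊆ fano.drawingᶜ := (disjoint_region_drawing i).subset_compl_right
  refine subset_antisymm ?_ ((isPreconnected_region i).subset_connectedComponentIn hp hsub)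
  refine isPreconnected_connectedComponentIn.subset_left_of_subset_union (isOpen_region i)
    (isClosed_closure (s := region i)).isOpen_compl
    (Set.disjoint_compl_right_iff_subset.2 subset_closure) ?_
    ⟨p, mem_connectedComponentIn (hsub hp), hp⟩
  intro q hq
  by_cases h : q ∈ region i
  · exact Or.inl h
  · refine Or.inr fun hc => ?_
    rw [closure_region] at hc
    exact connectedComponentIn_subset _ _ hq ((closedRegion_subset i hc).resolve_left h)

theorem region_nonempty (i : Fin 10) : (region i).Nonempty := by
  rw [← closure_nonempty_iff, closure_region, closedRegion]
  split_ifs with h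
  · exact ⟨fano.pos 2, fun hc => by
      have := hc.1
      rw [area_pos, Int.cast_pos] at this
      revert this; decide⟩
  · refine ⟨fano.pos (triangle i 0), ?_, ?_, ?_⟩ <;> rw [area_pos, Int.cast_nonneg_iff] <;>
    revert i <;> decide +kernel

theorem region_mem_faces (i : Fin 10) : region i ∈ fano.faces := by
  obtain ⟨p, hp⟩ := region_nonempty i
  exact ⟨p, (disjoint_region_drawing i).subset_compl_right hp, (component_eq_region hp).symm⟩

/-- The `i`-th face. -/
def fanoFace (i : Fin 10) : fano.faces := ⟨region i, region_mem_faces i⟩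

theorem fanoFace_surjective : Function.Surjective fanoFace := by
  rintro ⟨F, p, hp, rfl⟩
  obtain ⟨i, hi⟩ := Set.mem_iUnion.1 (compl_drawing_subset hp)
  exact ⟨i, Subtype.ext (component_eq_region hi).symm⟩

/-- The vertex `v` lies in the closure of the `i`-th face. -/
def VertexOn (v : Fin 7) (i : Fin 10) : Prop := ∃ k, triangle i k = v

/-- The `j`-th edge lies in the closure of the `i`-th face. -/
def EdgeOn (j : Fin 15) (i : Fin 10) : Prop := VertexOn (edgeFst j) i ∧ VertexOn (edgeSnd j) i

instance (v : Fin 7) (i : Fin 10) : Decidable (VertexOn v i) := by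
  unfold VertexOn; infer_instance

instance (j : Fin 15) (i : Fin 10) : Decidable (EdgeOn j i) := by
  unfold EdgeOn; infer_instance

theorem vertexOn_iff (v : Fin 7) (i : Fin 10) : fano.pos v ∈ closedRegion i ↔ VertexOn v i := by
  have h1 : ∀ v, ¬ (0 < fanoArea (triangle 9 0) (triangle 9 1) v ∧
      0 < fanoArea (triangle 9 1) (triangle 9 2) v ∧
      0 < fanoArea (triangle 9 2) (triangle 9 0) v) ↔ VertexOn v 9 := by decide +kernel
  have h2 : ∀ i, ¬ i = 9 → ∀ v, (0 ≤ fanoArea (triangle i 0) (triangle i 1) v ∧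
      0 ≤ fanoArea (triangle i 1) (triangle i 2) v ∧
      0 ≤ fanoArea (triangle i 2) (triangle i 0) v) ↔ VertexOn v i := by decide +kernel
  unfold closedRegion
  split_ifs with h
  · rw [h, ← h1]
    simp only [openTriangle, openTri, Set.mem_compl_iff, Set.mem_ofPred_eq, area_pos, Int.cast_pos]
  · rw [← h2 i h]
    simp only [closedTriangle, closedTri, Set.mem_ofPred_eq, area_pos, Int.cast_nonneg_iff]

theorem edgeSegment_fanoEdge (j : Fin 15) :
    fano.edgeSegment (fanoEdge j) = segment ℝ (fano.pos (edgeFst j)) (fano.pos (edgeSnd j)) :=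
  edgeSegment_mk _ _ _

/-- For an inner face the endpoints suffice because closed triangles are convex. The closure of the
outer face is not convex; there, an edge with both endpoints on it lies weakly beyond a single side
of the outer triangle. -/
theorem edgeOn_iff (j : Fin 15) (i : Fin 10) :
    fano.edgeSegment (fanoEdge j) ⊆ closedRegion i ↔ EdgeOn j i := by
  constructor
  · intro h
    rw [edgeSegment_fanoEdge] at h
    exact ⟨(vertexOn_iff _ _).1 (h (left_mem_segment _ _ _)),
      (vertexOn_iff _ _).1 (h (right_mem_segment _ _ _))⟩
  · intro h
    rw [edgeSegment_fanoEdge]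
    intro p hp
    unfold closedRegion
    split_ifs with h9
    · subst h9
      have : ∀ j, EdgeOn j 9 → ∃ k : Fin 3,
        fanoArea (triangle 9 k) (triangle 9 (k + 1)) (edgeFst j) ≤ 0 ∧
        fanoArea (triangle 9 k) (triangle 9 (k + 1)) (edgeSnd j) ≤ 0 := by decide +kernel
      obtain ⟨k, h1, h2⟩ := this j h
      have hk := area_nonpos_of_mem_segment hp h1 h2
      rintro ⟨p0, p1, p2⟩
      fin_cases k
      · exact absurd hk (not_le.2 p0)
      · exact absurd hk (not_le.2 p1)
      · exact absurd hk (not_le.2 p2)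
    · have : ∀ i, ¬ i = 9 → ∀ j, EdgeOn j i → ∀ k : Fin 3,
        0 ≤ fanoArea (triangle i k) (triangle i (k + 1)) (edgeFst j) ∧
        0 ≤ fanoArea (triangle i k) (triangle i (k + 1)) (edgeSnd j) := by decide +kernel
      have := this i h9 j h
      exact ⟨area_nonneg_of_mem_segment hp (this 0).1 (this 0).2,
        area_nonneg_of_mem_segment hp (this 1).1 (this 1).2,
        area_nonneg_of_mem_segment hp (this 2).1 (this 2).2⟩

theorem fanoFace_injective : Function.Injective fanoFace := by
  intro i i' h
  have h' : closedRegion i = closedRegion i' := by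
    rw [← closure_region, ← closure_region, show region i = region i' from congrArg Subtype.val h]
  have key : ∀ v, VertexOn v i ↔ VertexOn v i' := by
    intro v; rw [← vertexOn_iff, ← vertexOn_iff, h']
  clear h h'
  revert i i'; decide +kernel

theorem edgeOn_frontier {j : Fin 15} {i : Fin 10} (h : EdgeOn j i) :
    fano.edgeSegment (fanoEdge j) ⊆ frontier (region i) := by
  rw [(isOpen_region i).frontier_eq, closure_region]
  refine fun p hp => ⟨(edgeOn_iff j i).2 h hp, fun hr => ?_⟩
  refine Set.disjoint_left.1 (disjoint_region_drawing i) hr ?_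
  rw [drawing_eq]
  exact Set.mem_iUnion.2 ⟨j, by rwa [← edgeSegment_fanoEdge]⟩

/-! ### Planarity, connectivity and the rank function -/

theorem vertex_mem_fanoEdge_of_mem_segment {j : Fin 15} {v : Fin 7}
    (h : fano.pos v ∈ fano.edgeSegment (fanoEdge j)) : v ∈ fanoEdge j := by
  by_contra hv
  have : ∀ j v, v ∉ fanoEdge j → ∃ a b, fanoArea a b (edgeFst j) ≤ 0 ∧
      fanoArea a b (edgeSnd j) ≤ 0 ∧ 0 < fanoArea a b v := by decide +kernel
  obtain ⟨a, b, h1, h2, h3⟩ := this j v hv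
  rw [edgeSegment_fanoEdge] at h
  have h4 := area_nonpos_of_mem_segment h h1 h2
  rw [area_pos] at h4
  have h5 : (0 : ℝ) < fanoArea a b v := by exact_mod_cast h3
  linarith

/-- The edges `(a, b)` and `(a, d)` meet only in `a`, as they are separated by a line
through `a`. -/
theorem eq_of_mem_segment_of_separated {x y a b d : Fin 7} {p : ℝ × ℝ}
    (h1 : p ∈ segment ℝ (fano.pos a) (fano.pos b)) (h2 : p ∈ segment ℝ (fano.pos a) (fano.pos d))
    (ha : fanoArea x y a = 0) (hb : fanoArea x y b ≤ 0) (hd : 0 < fanoArea x y d) :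
    p = fano.pos a := by
  have h := area_nonpos_of_mem_segment h1 ha.le hb
  obtain ⟨t, h0, -, rfl⟩ := mem_segment_iff_exists.1 h2
  rw [area_lineMap, area_pos, area_pos, ha] at h
  have hd' : (0 : ℝ) < fanoArea x y d := by exact_mod_cast hd
  have : t = 0 := by
    by_contra hne
    have := mul_pos (lt_of_le_of_ne h0 (Ne.symm hne)) hd'
    simp at h; linarith
  simp [this]

theorem not_mem_segment_of_separated {x y a b c d : Fin 7} {p : ℝ × ℝ}
    (h1 : p ∈ segment ℝ (fano.pos a) (fano.pos b)) (h2 : p ∈ segment ℝ (fano.pos c) (fano.pos d))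
    (ha : fanoArea x y a ≤ 0) (hb : fanoArea x y b ≤ 0) (hc : 0 < fanoArea x y c)
    (hd : 0 < fanoArea x y d) : False := by
  have h := area_nonpos_of_mem_segment h1 ha hb
  obtain ⟨t, h0, ht1, rfl⟩ := mem_segment_iff_exists.1 h2
  rw [area_lineMap, area_pos, area_pos] at h
  have hc' : (0 : ℝ) < fanoArea x y c := by exact_mod_cast hc
  have hd' : (0 : ℝ) < fanoArea x y d := by exact_mod_cast hd
  rcases h0.eq_or_lt with rfl | h0
  · simp at h; linarith
  · nlinarith [mul_pos h0 hd', mul_nonneg (sub_nonneg.2 ht1) hc'.le]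

theorem fano_isPlane : fano.IsPlane := by
  refine ⟨fano_pos_injective, ?_, ?_⟩
  · intro e he v hv
    obtain ⟨j, rfl⟩ := (mem_edgeSet_iff e).1 he
    exact vertex_mem_fanoEdge_of_mem_segment hv
  · intro e he e' he' hne p hp
    obtain ⟨i, rfl⟩ := (mem_edgeSet_iff e).1 he
    obtain ⟨j, rfl⟩ := (mem_edgeSet_iff e').1 he'
    have hij : i ≠ j := fun h => hne (congrArg _ h)
    -- Any two edges are separated by a line through two vertices of `H`: one that passes through
    -- the common endpoint `a`, or one that has the second edge strictly on one side.
    have key : ∀ i j, i ≠ j → (∃ a b, fanoEdge i = s(a, b) ∧ ∃ d, fanoEdge j = s(a, d) ∧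
        ∃ x y, fanoArea x y a = 0 ∧ fanoArea x y b ≤ 0 ∧ 0 < fanoArea x y d) ∨
      (∃ x y, fanoArea x y (edgeFst i) ≤ 0 ∧ fanoArea x y (edgeSnd i) ≤ 0 ∧
        0 < fanoArea x y (edgeFst j) ∧ 0 < fanoArea x y (edgeSnd j)) ∨
      ∃ x y, fanoArea x y (edgeFst j) ≤ 0 ∧ fanoArea x y (edgeSnd j) ≤ 0 ∧
        0 < fanoArea x y (edgeFst i) ∧ 0 < fanoArea x y (edgeSnd i) := by decide +kernel
    rcases key i j hij with ⟨a, b, h1, d, h2, x, y, ha, hb, hd⟩ | ⟨x, y, h1, h2, h3, h4⟩ |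
      ⟨x, y, h1, h2, h3, h4⟩
    · rw [h1, h2] at hp ⊢
      rw [edgeSegment_mk, edgeSegment_mk] at hp
      exact ⟨a, by simp, by simp, eq_of_mem_segment_of_separated hp.1 hp.2 ha hb hd⟩
    · rw [edgeSegment_fanoEdge, edgeSegment_fanoEdge] at hp
      exact (not_mem_segment_of_separated hp.1 hp.2 h1 h2 h3 h4).elim
    · rw [edgeSegment_fanoEdge, edgeSegment_fanoEdge] at hp
      exact (not_mem_segment_of_separated hp.2 hp.1 h1 h2 h3 h4).elim

theorem connected_induce_of_short_paths {V : Type*} (G : SimpleGraph V) (T : Set V)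
    (hne : T.Nonempty) (h : ∀ x ∈ T, ∀ y ∈ T, ∃ z ∈ T, ∃ w ∈ T,
      (x = z ∨ G.Adj x z) ∧ (z = w ∨ G.Adj z w) ∧ (w = y ∨ G.Adj w y)) :
    (G.induce T).Connected := by
  have step : ∀ x y : T, (x.1 = y.1 ∨ G.Adj x y) → (G.induce T).Reachable x y := by
    rintro x y (h | h)
    · rw [Subtype.ext h]
    · exact SimpleGraph.Adj.reachable (G := G.induce T) h
  have : Nonempty T := hne.to_subtype
  refine ⟨fun x y => ?_⟩
  obtain ⟨z, hz, w, hw, h1, h2, h3⟩ := h x x.2 y y.2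
  exact ((step x ⟨z, hz⟩ h1).trans (step ⟨z, hz⟩ ⟨w, hw⟩ h2)).trans (step ⟨w, hw⟩ y h3)

/-- When at most two vertices are deleted, the remaining ones still have pairwise distance at most
three. Deleting a single vertex is the case `a = b`. -/
theorem fano_threeConnected : ThreeConnected fano.graph := by
  refine ⟨by simp, fun S hS => ?_⟩
  have key : ∀ a b x y : Fin 7, ¬ (x = a ∨ x = b) → ¬ (y = a ∨ y = b) →
      ∃ z, ¬ (z = a ∨ z = b) ∧ ∃ w, ¬ (w = a ∨ w = b) ∧ (x = z ∨ fano.graph.Adj x z) ∧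
        (z = w ∨ fano.graph.Adj z w) ∧ (w = y ∨ fano.graph.Adj w y) := by decide +kernel
  have key₀ : ∀ x y : Fin 7, ∃ z w : Fin 7, (x = z ∨ fano.graph.Adj x z) ∧
        (z = w ∨ fano.graph.Adj z w) ∧ (w = y ∨ fano.graph.Adj w y) := by decide +kernel
  have hne : ∀ a b : Fin 7, ∃ x, ¬ (x = a ∨ x = b) := by decide +kernel
  have hpair : ∀ a b : Fin 7, (fano.graph.induce ({a, b} : Set (Fin 7))ᶜ).Connected :=
    fun a b => connected_induce_of_short_paths _ _ (hne a b)
      fun x hx y hy => by simpa [and_assoc] using key a b x y hx hy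
  have hS' : S.encard = 0 ∨ S.encard = 1 ∨ S.encard = 2 := by
    obtain ⟨n, hn⟩ := ENat.ne_top_iff_exists.1 (ne_top_of_lt hS)
    rw [← hn] at hS ⊢
    have : n < 3 := by exact_mod_cast hS
    interval_cases n <;> simp
  rcases hS' with h | h | h
  · rw [Set.encard_eq_zero.1 h]
    refine connected_induce_of_short_paths _ _ ⟨0, by simp⟩ fun x _ y _ => ?_
    simpa using key₀ x y
  · obtain ⟨a, rfl⟩ := Set.encard_eq_one.1 h
    have := hpair a a
    rwa [Set.pair_eq_singleton] at this
  · obtain ⟨a, b, -, rfl⟩ := Set.encard_eq_two.1 h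
    exact hpair a b

namespace StraightLineGraph.Cell

theorem lt_of_dim_lt {V : Type*} {H : StraightLineGraph V} {x y : H.Cell} (h : x.dim < y.dim)
    (hc : x.carrier ⊆ y.carrier) : x < y :=
  lt_of_le_of_ne (Or.inr ⟨h, hc⟩) (by rintro rfl; exact h.false)

theorem dim_lt_of_lt {V : Type*} {H : StraightLineGraph V} {x y : H.Cell} (h : x < y) :
    x.dim < y.dim ∧ x.carrier ⊆ y.carrier := by
  rcases h.le with rfl | h'
  · exact absurd h (lt_irrefl _)
  · exact h'

end StraightLineGraph.Cell

open StraightLineGraph in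
theorem exists_edge_between {v : Fin 7} {F : fano.faces}
    (h : (Cell.vertex v : fano.Cell) < Cell.face F) :
    ∃ e, (Cell.vertex v : fano.Cell) < Cell.edge e ∧ Cell.edge e < Cell.face F := by
  obtain ⟨i, rfl⟩ := fanoFace_surjective F
  have h1 : fano.pos v ∈ closure (region i) := by
    simpa [Cell.carrier, fanoFace] using (Cell.dim_lt_of_lt h).2
  rw [closure_region, vertexOn_iff] at h1
  have : ∀ i v, VertexOn v i → ∃ j, EdgeOn j i ∧ v ∈ fanoEdge j := by decide +kernel
  obtain ⟨j, h2, h3⟩ := this i v h1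
  refine ⟨⟨fanoEdge j, fanoEdge_mem j⟩, Cell.lt_of_dim_lt (by simp [Cell.dim]) ?_,
    Cell.lt_of_dim_lt (by simp [Cell.dim]) ?_⟩
  · rintro _ rfl
    exact subset_convexHull ℝ _ ⟨v, h3, rfl⟩
  · change _ ⊆ closure (region i)
    rw [closure_region]
    exact (edgeOn_iff j i).2 h2

-- For comparable cells whose dimensions differ by more than one, a cell strictly between them is
-- exhibited, so they do not form a cover.
open StraightLineGraph in
theorem fano_isRankFunction : IsRankFunction (Cell.dim : fano.Cell → ℤ) := by
  intro x y hxy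
  by_contra hne
  have hlt := Cell.dim_lt_of_lt hxy.lt
  suffices ∃ z, x < z ∧ z < y by
    obtain ⟨z, h1, h2⟩ := this
    exact hxy.2 h1 h2
  have empty_lt : ∀ v, (Cell.empty : fano.Cell) < Cell.vertex v := fun v =>
    Cell.lt_of_dim_lt (by simp [Cell.dim]) (Set.empty_subset _)
  have lt_whole : ∀ F, (Cell.face F : fano.Cell) < Cell.whole := fun F =>
    Cell.lt_of_dim_lt (by simp [Cell.dim]) (Set.subset_univ _)
  have face_vertex : ∀ i : Fin 10, (Cell.vertex (triangle i 0) : fano.Cell) <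
      Cell.face (fanoFace i) := fun i => by
    refine Cell.lt_of_dim_lt (by simp [Cell.dim]) ?_
    rintro _ rfl
    change _ ∈ closure (region i)
    rw [closure_region, vertexOn_iff]
    exact ⟨0, rfl⟩
  rcases x with _ | v | e | F | _ <;> rcases y with _ | w | e' | F' | _ <;>
    simp only [Cell.dim] at hlt hne <;> (try omega)
  · obtain ⟨e', he'⟩ := e'
    induction e' with | _ a b
    refine ⟨Cell.vertex a, empty_lt a, Cell.lt_of_dim_lt (by simp [Cell.dim]) ?_⟩
    rintro _ rfl
    exact subset_convexHull ℝ _ ⟨a, by simp, rfl⟩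
  · obtain ⟨i, rfl⟩ := fanoFace_surjective F'
    exact ⟨_, empty_lt _, face_vertex i⟩
  · exact ⟨_, (empty_lt _).trans (face_vertex 0), lt_whole _⟩
  · obtain ⟨e, h⟩ := exists_edge_between hxy.lt
    exact ⟨_, h⟩
  · have : ∀ v, ∃ i, VertexOn v i := by decide +kernel
    obtain ⟨i, hi⟩ := this v
    refine ⟨Cell.face (fanoFace i), Cell.lt_of_dim_lt (by simp [Cell.dim]) ?_, lt_whole _⟩
    rintro _ rfl
    change _ ∈ closure (region i)
    rwa [closure_region, vertexOn_iff]
  · obtain ⟨e, he⟩ := e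
    obtain ⟨j, rfl⟩ := (mem_edgeSet_iff e).1 he
    have : ∀ j, ∃ i, EdgeOn j i := by decide +kernel
    obtain ⟨i, hi⟩ := this j
    refine ⟨Cell.face (fanoFace i), Cell.lt_of_dim_lt (by simp [Cell.dim]) ?_, lt_whole _⟩
    change _ ⊆ closure (region i)
    rw [closure_region]
    exact (edgeOn_iff j i).2 hi

/-! ### Hamiltonian cycles -/

theorem isHamiltonianCycle_of_support_tail {V : Type*} [DecidableEq V] {G : SimpleGraph V} {u : V}
    (p : G.Walk u u) (hlen : 3 ≤ p.length) (hn : p.support.tail.Nodup)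
    (h : ∀ a, a ∈ p.support.tail) : p.IsHamiltonianCycle := by
  rw [SimpleGraph.Walk.isHamiltonianCycle_iff_isCycle_and_support_count_tail_eq_one,
    SimpleGraph.Walk.isCycle_iff_isPath_tail_and_le_length]
  have hnil : ¬ p.Nil := by
    rw [← SimpleGraph.Walk.length_eq_zero_iff]; omega
  refine ⟨⟨?_, hlen⟩, fun a => List.count_eq_one_of_mem hn (h a)⟩
  rwa [SimpleGraph.Walk.isPath_def, SimpleGraph.Walk.support_tail_of_not_nil p hnil]

theorem exists_hamiltonianCycle {V : Type*} [DecidableEq V] {G : SimpleGraph V} (u : V)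
    (l : List V) (hc : List.IsChain G.Adj (u :: (l ++ [u]))) (hlen : 2 ≤ l.length)
    (hn : (l ++ [u]).Nodup) (h : ∀ a, a ∈ l ++ [u]) :
    ∃ p : G.Walk u u, p.support = u :: (l ++ [u]) ∧ p.IsHamiltonianCycle := by
  obtain ⟨p, hp⟩ : ∃ p : G.Walk u u, p.support = u :: (l ++ [u]) := by
    have key : ∀ {a b : V} (w : G.Walk a b), a = u → b = u → w.support = u :: (l ++ [u]) →
        ∃ p : G.Walk u u, p.support = u :: (l ++ [u]) := by
      rintro a b w rfl rfl h
      exact ⟨w, h⟩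
    exact key (SimpleGraph.Walk.ofSupport _ (List.cons_ne_nil u (l ++ [u])) hc) rfl (by simp)
      (SimpleGraph.Walk.support_ofSupport _ _)
  have hl : p.length = l.length + 1 := by
    have := p.length_support
    rw [hp] at this
    simp at this; omega
  refine ⟨p, hp, isHamiltonianCycle_of_support_tail p (by omega) ?_ ?_⟩ <;> rw [hp]
  exacts [hn, h]

theorem fano_hasHamiltonianCycle : HasHamiltonianCycle fano.graph := by
  classical
  obtain ⟨p, -, hp⟩ := exists_hamiltonianCycle (G := fano.graph) 0 [1, 2, 3, 4, 5, 6]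
    (by decide +kernel) (by decide) (by decide) (by decide)
  exact ⟨0, p, by convert hp⟩

theorem dual_adj {i i' : Fin 10} (h : i ≠ i') (h' : ∃ j, EdgeOn j i ∧ EdgeOn j i') :
    fano.dual.Adj (fanoFace i) (fanoFace i') := by
  obtain ⟨j, h1, h2⟩ := h'
  exact ⟨fanoFace_injective.ne h, fanoEdge j, fanoEdge_mem j, edgeOn_frontier h1,
    edgeOn_frontier h2⟩

theorem fano_hasHamiltonianCycle_dual : HasHamiltonianCycle fano.dual := by
  classical
  obtain ⟨p, -, hp⟩ := exists_hamiltonianCycle (G := fano.dual) (fanoFace 9)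
    ([1, 0, 2, 3, 4, 5, 8, 7, 6].map fanoFace) (by
      have : List.IsChain (fun i i' : Fin 10 => i ≠ i' ∧ ∃ j, EdgeOn j i ∧ EdgeOn j i')
        [9, 1, 0, 2, 3, 4, 5, 8, 7, 6, 9] := by decide +kernel
      exact List.isChain_map_of_isChain fanoFace (fun i i' h => dual_adj h.1 h.2) this)
    (by decide) ((List.nodup_map_iff fanoFace_injective (l := [1, 0, 2, 3, 4, 5, 8, 7, 6, 9])).2
      (by decide)) (fun F => by
      obtain ⟨i, rfl⟩ := fanoFace_surjective F
      have : ∀ i : Fin 10, i ∈ [1, 0, 2, 3, 4, 5, 8, 7, 6, (9 : Fin 10)] := by decide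
      exact List.mem_map_of_mem (this i))
  exact ⟨_, p, by convert hp⟩

/-- The edges of a walk with the given list of vertices. -/
def listEdges (l : List (Fin 7)) : List (Sym2 (Fin 7)) := List.zipWith (s(·, ·)) l l.tail

/-- The automorphisms of the graph. -/
def fanoAut : Fin 6 → Fin 7 → Fin 7 :=
  ![![0, 1, 2, 3, 4, 5, 6], ![0, 1, 5, 6, 4, 2, 3], ![0, 3, 2, 1, 5, 4, 6],
    ![0, 3, 4, 6, 5, 2, 1], ![0, 6, 4, 3, 2, 5, 1], ![0, 6, 5, 1, 2, 4, 3]]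

theorem fanoAut_injective (k : Fin 6) : Function.Injective (fanoAut k) := by
  have : ∀ k a b, fanoAut k a = fanoAut k b → a = b := by decide +kernel
  exact this k

/-- The automorphisms of the graph, as graph isomorphisms. -/
noncomputable def fanoIso (k : Fin 6) : fano.graph ≃g fano.graph where
  toEquiv := Equiv.ofBijective (fanoAut k) (Finite.injective_iff_bijective.1 (fanoAut_injective k))
  map_rel_iff' := by
    have : ∀ k a b, fano.graph.Adj (fanoAut k a) (fanoAut k b) ↔ fano.graph.Adj a b := by
      decide +kernel
    exact fun {a b} => this k a b

/-- Some automorphism maps the edges of the closed walk `l` onto those of the closed walk `l'`. -/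
def ListEquiv (l l' : List (Fin 7)) : Prop :=
  ∃ k, (∀ e ∈ listEdges l, Sym2.map (fanoAut k) e ∈ listEdges l') ∧
    ∀ e' ∈ listEdges l', ∃ e ∈ listEdges l, Sym2.map (fanoAut k) e = e'

instance (l l' : List (Fin 7)) : Decidable (ListEquiv l l') := by
  unfold ListEquiv; infer_instance

/-- The vertices with the numbers `i` and `j` of the list `l` form an edge outside `E`. -/
def ListChord (E : List (Sym2 (Fin 7))) (l : List (Fin 7)) (i j : ℕ) : Prop :=
  fano.graph.Adj (l.getD i 0) (l.getD j 0) ∧ s(l.getD i 0, l.getD j 0) ∉ E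

instance (E : List (Sym2 (Fin 7))) (l : List (Fin 7)) (i j : ℕ) : Decidable (ListChord E l i j) := by
  unfold ListChord; infer_instance

/-- The closed walk `0 :: t` can be rotated so that it has three separated chords. -/
def ListViolates (t : List (Fin 7)) : Prop :=
  ∃ u, ∀ n ≤ 7, (t.rotate n).getLast? = some u →
    ListChord (listEdges (0 :: t)) (u :: t.rotate n) 0 2 ∧
    ListChord (listEdges (0 :: t)) (u :: t.rotate n) 2 4 ∧
    ListChord (listEdges (0 :: t)) (u :: t.rotate n) 4 6

instance (t : List (Fin 7)) : Decidable (ListViolates t) := by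
  unfold ListViolates; infer_instance

-- An exhaustive enumeration. Each vertex is constrained before the next is chosen, so that branches
-- are cut off early.
set_option synthInstance.maxSize 1000 in
set_option synthInstance.maxHeartbeats 400000 in
theorem listViolates_and_listEquiv : ∀ a, fano.graph.Adj 0 a → ∀ b, fano.graph.Adj a b → b ≠ 0 →
    ∀ c, fano.graph.Adj b c → c ∉ [0, a] → ∀ d, fano.graph.Adj c d → d ∉ [0, a, b] →
    ∀ e, fano.graph.Adj d e → e ∉ [0, a, b, c] →
    ∀ f, fano.graph.Adj e f → f ∉ [0, a, b, c, d] → fano.graph.Adj f 0 →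
    ListViolates [a, b, c, d, e, f, 0] ∧
      (ListEquiv [0, a, b, c, d, e, f, 0] [0, 1, 2, 3, 4, 5, 6, 0] ∨
      ListEquiv [0, a, b, c, d, e, f, 0] [0, 5, 1, 2, 3, 4, 6, 0]) := by
  decide +kernel

theorem mem_edges_iff {u v : Fin 7} {p : fano.graph.Walk u v} {l : List (Fin 7)}
    (h : p.support = l) (e : Sym2 (Fin 7)) : e ∈ p.edges ↔ e ∈ listEdges l := by
  rw [SimpleGraph.Walk.edges_eq_zipWith_support, h, listEdges]

theorem equivCycles_of_listEquiv {u v : Fin 7} {C : fano.graph.Walk u u} {D : fano.graph.Walk v v}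
    {l l' : List (Fin 7)} (hC : ∀ e, e ∈ C.edges ↔ e ∈ listEdges l)
    (hD : ∀ e, e ∈ D.edges ↔ e ∈ listEdges l') (h : ListEquiv l l') : EquivCycles C D := by
  obtain ⟨k, h1, h2⟩ := h
  refine ⟨fanoIso k, ?_⟩
  ext e
  simp only [Set.mem_image, Set.mem_ofPred_eq, hC, hD]
  constructor
  · rintro ⟨e, he, rfl⟩
    exact h1 e he
  · exact h2 e

theorem isChord_of_listChord {u : Fin 7} {C : fano.graph.Walk u u} {E : List (Sym2 (Fin 7))}
    {l : List (Fin 7)} (hl : C.support = l) (hE : ∀ e, e ∈ C.edges ↔ e ∈ E) {i j : ℕ}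
    (hi : i ≤ C.length) (hj : j ≤ C.length) (h : ListChord E l i j) :
    IsChord C (C.getVert i) (C.getVert j) := by
  have key : ∀ i ≤ C.length, C.getVert i = l.getD i 0 := by
    intro i hi
    rw [List.getD_eq_getElem?_getD, ← hl, ← SimpleGraph.Walk.getVert_eq_support_getElem? C hi]
    rfl
  rw [IsChord, key i hi, key j hj, hE]
  exact h

/-- Rotating `C` to start at `x` rotates `t` by an amount `n` of which only the resulting last entry
`x` is known; this is why `ListViolates` quantifies over all `n`. -/
theorem not_chordCondition_of_listViolates {u v : Fin 7} {C : fano.graph.Walk u u}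
    {C₀ : fano.graph.Walk v v} (hC : C.IsHamiltonianCycle) {t : List (Fin 7)}
    (hs : C.support.tail ~r C₀.support.tail) (ht : C₀.support.tail = t)
    (he : ∀ e, e ∈ C.edges ↔ e ∈ listEdges (0 :: t)) (h : ListViolates t) :
    ¬ ChordCondition C := by
  intro hcond
  obtain ⟨x, hx⟩ := h
  have hxC := hC.mem_support x
  apply hcond x hxC
  have hlen : (C.rotate x hxC).length = 7 := by
    rw [SimpleGraph.Walk.length_rotate, hC.length_eq, Fintype.card_fin]
  obtain ⟨n, hn, hrot⟩ : ∃ n ≤ t.length, t.rotate n = (C.rotate x hxC).support.tail := by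
    rw [← List.isRotated_iff_mod, ← ht]
    exact ((C.support_rotate x hxC).trans hs).symm
  have htl : t.length = 7 := by
    have := congrArg List.length hrot
    simpa [hlen] using this
  have hlast : (t.rotate n).getLast? = some x := by
    rw [hrot]
    have h1 := (C.rotate x hxC).getLast_support
    have h2 : (C.rotate x hxC).support.tail ≠ [] := by
      rw [← List.length_pos_iff]; simp [hlen]
    rw [List.getLast?_eq_some_getLast h2, List.getLast_tail, h1]
  have hsup : (C.rotate x hxC).support = x :: t.rotate n := by
    rw [hrot, SimpleGraph.Walk.cons_tail_support]
  have hE : ∀ e, e ∈ (C.rotate x hxC).edges ↔ e ∈ listEdges (0 :: t) := fun e => by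
    rw [(C.rotate_edges x hxC).mem_iff, he]
  obtain ⟨h1, h2, h3⟩ := hx n (by omega) hlast
  exact ⟨0, 2, 2, 4, 4, 6, by omega, le_rfl, by omega, le_rfl, by omega, by omega,
    isChord_of_listChord hsup hE (by omega) (by omega) h1,
    isChord_of_listChord hsup hE (by omega) (by omega) h2,
    isChord_of_listChord hsup hE (by omega) (by omega) h3⟩

theorem hamiltonianCycle_classification {v : Fin 7} {C : fano.graph.Walk v v}
    (hC : C.IsHamiltonianCycle) {C₁ C₂ : fano.graph.Walk 0 0}
    (h₁ : C₁.support = [0, 1, 2, 3, 4, 5, 6, 0]) (h₂ : C₂.support = [0, 5, 1, 2, 3, 4, 6, 0]) :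
    (EquivCycles C C₁ ∨ EquivCycles C C₂) ∧ ¬ ChordCondition C := by
  have h0 := hC.mem_support 0
  set D := C.rotate 0 h0 with hD
  have hDH : D.IsHamiltonianCycle := (SimpleGraph.Walk.isHamiltonianCycle_rotate h0).2 hC
  have hlen : D.length = 7 := by rw [hDH.length_eq, Fintype.card_fin]
  obtain ⟨a, b, c, d, e, f, ht⟩ : ∃ a b c d e f, D.support.tail = [a, b, c, d, e, f, 0] := by
    have hl : D.support.tail.length = 7 := by simp [hlen]
    have hlast : D.support.tail.getLast? = some 0 := by
      have h2 : D.support.tail ≠ [] := by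
        rw [← List.length_pos_iff]; omega
      rw [List.getLast?_eq_some_getLast h2, List.getLast_tail, D.getLast_support]
    generalize D.support.tail = t at hl hlast
    match t, hl with
    | [a, b, c, d, e, f, g], _ =>
      simp at hlast
      exact ⟨a, b, c, d, e, f, by rw [hlast]⟩
  have hsup : D.support = 0 :: [a, b, c, d, e, f, 0] := by
    rw [← ht, SimpleGraph.Walk.cons_tail_support]
  have hch := D.isChain_adj_support
  have hnd := hDH.isCycle.support_nodup
  rw [ht] at hnd
  rw [hsup] at hch
  have hE : ∀ e', e' ∈ C.edges ↔ e' ∈ listEdges (0 :: [a, b, c, d, e, f, 0]) := fun e' => by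
    rw [← mem_edges_iff hsup, hD, (C.rotate_edges 0 h0).mem_iff]
  simp only [List.isChain_cons_cons] at hch
  obtain ⟨c1, c2, c3, c4, c5, c6, c7, -⟩ := hch
  obtain ⟨hv, heq⟩ := listViolates_and_listEquiv a c1 b c2 (by grind) c c3 (by grind) d c4
    (by grind) e c5 (by grind) f c6 (by grind) c7
  exact ⟨heq.imp (equivCycles_of_listEquiv hE (mem_edges_iff h₁))
    (equivCycles_of_listEquiv hE (mem_edges_iff h₂)),
    not_chordCondition_of_listViolates hC (C.support_rotate 0 h0).symm ht hE hv⟩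

set_option synthInstance.maxSize 1000 in
set_option synthInstance.maxHeartbeats 400000 in
theorem not_equivCycles {C₁ C₂ : fano.graph.Walk 0 0}
    (h₁ : C₁.support = [0, 1, 2, 3, 4, 5, 6, 0]) (h₂ : C₂.support = [0, 5, 1, 2, 3, 4, 6, 0]) :
    ¬ EquivCycles C₁ C₂ := by
  rintro ⟨φ, hφ⟩
  have hE : ∀ a b, s(a, b) ∈ listEdges [0, 1, 2, 3, 4, 5, 6, 0] →
      s(φ a, φ b) ∈ listEdges [0, 5, 1, 2, 3, 4, 6, 0] := by
    intro a b h
    rw [← mem_edges_iff h₂]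
    have : Sym2.map φ s(a, b) ∈ {e | e ∈ C₂.edges} := by
      rw [← hφ]
      exact ⟨_, (mem_edges_iff h₁ _).2 h, rfl⟩
    exact this
  have hA : ∀ a b, fano.graph.Adj a b → fano.graph.Adj (φ a) (φ b) := fun a b h => φ.map_adj_iff.2 h
  -- Here `a, …, f` are the images of the first six vertices of `C₁`. They would form a walk along
  -- `C₂` that keeps seven adjacencies of `H`, but every such walk repeats a vertex, contrary to the
  -- injectivity of `φ`.
  have key : ∀ a b, s(a, b) ∈ listEdges [0, 5, 1, 2, 3, 4, 6, 0] →
      ∀ c, s(b, c) ∈ listEdges [0, 5, 1, 2, 3, 4, 6, 0] → fano.graph.Adj a c →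
      ∀ d, s(c, d) ∈ listEdges [0, 5, 1, 2, 3, 4, 6, 0] → fano.graph.Adj a d →
      ∀ e, s(d, e) ∈ listEdges [0, 5, 1, 2, 3, 4, 6, 0] → fano.graph.Adj a e →
      fano.graph.Adj c e →
      ∀ f, s(e, f) ∈ listEdges [0, 5, 1, 2, 3, 4, 6, 0] → fano.graph.Adj a f →
      fano.graph.Adj c f → fano.graph.Adj b f → b = d ∨ b = f ∨ c = f := by decide +kernel
  have := key (φ 0) (φ 1) (hE 0 1 (by decide)) (φ 2) (hE 1 2 (by decide)) (hA 0 2 (by decide))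
    (φ 3) (hE 2 3 (by decide)) (hA 0 3 (by decide)) (φ 4) (hE 3 4 (by decide)) (hA 0 4 (by decide))
    (hA 2 4 (by decide)) (φ 5) (hE 4 5 (by decide)) (hA 0 5 (by decide)) (hA 2 5 (by decide))
    (hA 1 5 (by decide))
  simp only [EmbeddingLike.apply_eq_iff_eq] at this
  revert this
  decide

/-! ### Straight-line drawings on the cylinder -/

theorem toCylinder_eq_iff (p q : ℝ × ℝ) :
    toCylinder p = toCylinder q ↔ (∃ m : ℤ, p.1 = q.1 + m) ∧ p.2 = q.2 := by
  unfold toCylinder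
  rw [Prod.mk.injEq]
  refine and_congr_left fun _ => ?_
  rw [← sub_eq_zero, ← AddCircle.coe_sub, AddCircle.coe_eq_zero_iff]
  refine exists_congr fun m => ?_
  rw [zsmul_one]
  constructor <;> intro h <;> linarith

theorem toCylinder_add_int (a b : ℝ) (m : ℤ) : toCylinder (a + m, b) = toCylinder (a, b) :=
  (toCylinder_eq_iff _ _).2 ⟨⟨m, rfl⟩, rfl⟩

namespace CylinderDrawing

variable {P : Type*} {R : SimpleGraph P} {rk : P → ℤ} (D : CylinderDrawing R rk)

theorem mem_arc_iff (u v : P) (z : UnitAddCircle × ℝ) : z ∈ D.arc u v ↔ ∃ t : ℝ, 0 ≤ t ∧ t ≤ 1 ∧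
    z = toCylinder (D.x u + t * (D.x v + D.wind u v - D.x u), rk u + t * (rk v - rk u)) := by
  simp only [arc, Set.mem_image, mem_segment_iff_exists]
  constructor
  · rintro ⟨_, ⟨t, h0, h1, rfl⟩, rfl⟩
    exact ⟨t, h0, h1, by simp⟩
  · rintro ⟨t, h0, h1, rfl⟩
    exact ⟨_, ⟨t, h0, h1, rfl⟩, by simp⟩

theorem point_eq_iff (u v : P) :
    D.point u = D.point v ↔ (∃ m : ℤ, D.x u = D.x v + m) ∧ rk u = rk v := by
  simp [point, toCylinder_eq_iff]

variable {D}

/-- On an arc between consecutive ranks, only the two endpoints have integral heights. -/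
theorem eq_point_of_mem_arc {u v : P} (h : rk v = rk u + 1 ∨ rk u = rk v + 1)
    {z : UnitAddCircle × ℝ} (hz : z ∈ D.arc u v) {n : ℤ} (hn : z.2 = n) :
    z = D.point u ∨ z = D.point v := by
  obtain ⟨t, h0, h1, rfl⟩ := (D.mem_arc_iff u v z).1 hz
  have hd : t = 0 ∨ t = 1 := by
    by_contra! hc
    have l0 : 0 < t := lt_of_le_of_ne h0 hc.1.symm
    have l1 : t < 1 := lt_of_le_of_ne h1 hc.2
    simp only [toCylinder] at hn
    rcases h with h | h <;> rw [h] at hn <;> push_cast at hn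
    · have a1 : rk u < n := by exact_mod_cast (by linarith : (rk u : ℝ) < n)
      have a2 : n < rk u + 1 := by exact_mod_cast (by linarith : (n : ℝ) < rk u + 1)
      omega
    · have a1 : rk v < n := by exact_mod_cast (by linarith : (rk v : ℝ) < n)
      have a2 : n < rk v + 1 := by exact_mod_cast (by linarith : (n : ℝ) < rk v + 1)
      omega
  rcases hd with rfl | rfl
  · left; simp [point]
  · right
    simp only [one_mul, add_sub_cancel]
    exact toCylinder_add_int _ _ _

theorem left_mem_drawing (u : P) : D.point u ∈ D.drawing := Or.inl ⟨u, rfl⟩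

theorem eq_point_of_mem_drawing (hR : ∀ u v, R.Adj u v → rk v = rk u + 1 ∨ rk u = rk v + 1)
    {z : UnitAddCircle × ℝ} (hz : z ∈ D.drawing) {n : ℤ} (hn : z.2 = n) :
    ∃ c, rk c = n ∧ z = D.point c := by
  obtain ⟨c, rfl⟩ : ∃ c, z = D.point c := by
    rcases hz with ⟨c, rfl⟩ | hz
    · exact ⟨c, rfl⟩
    · simp only [Set.mem_iUnion] at hz
      obtain ⟨u, v, hu, hz⟩ := hz
      rcases eq_point_of_mem_arc (hR u v hu) hz hn with h | h
      exacts [⟨u, h⟩, ⟨v, h⟩]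
  refine ⟨c, ?_, rfl⟩
  simpa [point, toCylinder] using hn

/-- Two elements that are neighbors on the circle of their rank belong to a rhombus. -/
theorem exists_rhombus_of_gap (hR : ∀ u v, R.Adj u v → rk v = rk u + 1 ∨ rk u = rk v + 1)
    (hno : D.NoCrossing)
    (hface : ∀ p ∈ D.drawingᶜ, D.IsRhombus (connectedComponentIn D.drawingᶜ p))
    {a b : P} (hab : a ≠ b) (hr : rk b = rk a) {s t : ℝ} (hs : ∃ m : ℤ, s = D.x a + m)
    (ht : ∃ m : ℤ, t = D.x b + m) (hst : s < t)
    (hgap : ∀ c (k : ℤ), rk c = rk a → s < D.x c + k → t ≤ D.x c + k) :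
    ∃ lo hi, rk lo = rk a - 1 ∧ rk hi = rk a + 1 ∧ R.Adj lo a ∧ R.Adj lo b ∧ R.Adj a hi ∧
      R.Adj b hi := by
  obtain ⟨m, hm⟩ := hs
  obtain ⟨n, hn⟩ := ht
  set f : ℝ → UnitAddCircle × ℝ := fun y => toCylinder (y, rk a) with hf
  have hfc : Continuous f := by
    simp only [hf, toCylinder]
    exact ((AddCircle.continuous_mk' 1).comp continuous_id).prodMk continuous_const
  -- At an integral height the drawing has only its vertices, and `hgap` excludes those of rank `rk
  -- a`.
  have hIoo : f '' Set.Ioo s t ⊆ D.drawingᶜ := by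
    rintro _ ⟨y, hy, rfl⟩ hd
    obtain ⟨c, hc, he⟩ := eq_point_of_mem_drawing hR hd (n := rk a) rfl
    obtain ⟨⟨k, hk⟩, -⟩ := (toCylinder_eq_iff _ _).1 he
    simp only at hk
    have := hgap c k hc (by rw [← hk]; exact hy.1)
    rw [← hk] at this
    exact absurd hy.2 (not_lt.2 this)
  have hmid : (s + t) / 2 ∈ Set.Ioo s t := ⟨by linarith, by linarith⟩
  have hz : f ((s + t) / 2) ∈ D.drawingᶜ := hIoo ⟨_, hmid, rfl⟩
  set F := connectedComponentIn D.drawingᶜ (f ((s + t) / 2)) with hF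
  have hsub : f '' Set.Ioo s t ⊆ F :=
    (isPreconnected_Ioo.image f hfc.continuousOn).subset_connectedComponentIn ⟨_, hmid, rfl⟩ hIoo
  have hcl : ∀ y ∈ Set.Icc s t, f y ∈ closure F := by
    intro y hy
    rw [← closure_Ioo hst.ne] at hy
    exact closure_mono hsub (image_closure_subset_closure_image hfc ⟨y, hy, rfl⟩)
  have hfr : ∀ c, D.point c ∈ closure F → D.point c ∈ frontier F := fun c hc =>
    ⟨hc, fun hi => connectedComponentIn_subset _ _ (interior_subset hi) (left_mem_drawing c)⟩
  have ha : D.point a ∈ frontier F := hfr a (by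
    have := hcl s ⟨le_rfl, hst.le⟩
    rw [hm] at this
    rwa [hf, show (fun y => toCylinder (y, (rk a : ℝ))) (D.x a + m) = D.point a from
      toCylinder_add_int _ _ _] at this)
  have hb : D.point b ∈ frontier F := hfr b (by
    have := hcl t ⟨hst.le, le_rfl⟩
    rw [hn] at this
    rwa [hf, ← hr, show (fun y => toCylinder (y, (rk b : ℝ))) (D.x b + n) = D.point b from
      toCylinder_add_int _ _ _] at this)
  obtain ⟨a', b', c', d', hne, h1, h2, h3, h4, r1, r2, r3, hfront⟩ := hface _ hz
  rw [← hF] at hfront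
  have key : ∀ c, D.point c ∈ frontier F → c = a' ∨ c = b' ∨ c = c' ∨ c = d' := by
    intro c hc
    rw [hfront] at hc
    have harc : ∀ u v, R.Adj u v → D.point c ∈ D.arc u v → c = u ∨ c = v := fun u v h hc =>
      (eq_point_of_mem_arc (hR u v h) hc (n := rk c) rfl).imp (fun h => hno.1 h) (fun h => hno.1 h)
    rcases hc with ((hc | hc) | hc) | hc
    · have := harc _ _ h1 hc; tauto
    · have := harc _ _ h2 hc; tauto
    · have := harc _ _ h3 hc; tauto
    · have := harc _ _ h4 hc; tauto
  -- Two distinct corners of a rhombus with equal rank are the opposite corners `a'` and `c'`.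
  have hcases : (a = a' ∧ b = c') ∨ (a = c' ∧ b = a') := by
    rcases key a ha with rfl | rfl | rfl | rfl <;> rcases key b hb with rfl | rfl | rfl | rfl <;>
      first
      | exact absurd rfl hab
      | (exfalso; omega)
      | simp
  rcases hcases with ⟨rfl, rfl⟩ | ⟨rfl, rfl⟩
  · exact ⟨b', d', r2, r3, h1.symm, h2, h4.symm, h3⟩
  · exact ⟨b', d', by omega, by omega, h2, h1.symm, h3, h4.symm⟩

variable (D) in
/-- The straight line segment from `(p, rk u)` to `(q, rk v)` is a lift of the arc from `u` up
to `v`. -/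
def IsLift (u v : P) (p q : ℝ) : Prop :=
  R.Adj u v ∧ rk v = rk u + 1 ∧ ∃ m : ℤ, p = D.x u + m ∧ q = D.x v + D.wind u v + m

namespace IsLift

variable {u v u' v' : P} {p q p' q' : ℝ}

theorem exists_of_adj (h : R.Adj u v) (hr : rk v = rk u + 1) (hq : ∃ m : ℤ, q = D.x v + m) :
    ∃ p, D.IsLift u v p q := by
  obtain ⟨m, rfl⟩ := hq
  exact ⟨D.x u + (m - D.wind u v : ℤ), h, hr, m - D.wind u v, rfl, by push_cast; ring⟩

theorem add_one (h : D.IsLift u v p q) : D.IsLift u v (p + 1) (q + 1) := by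
  obtain ⟨h1, h2, m, rfl, rfl⟩ := h
  exact ⟨h1, h2, m + 1, by push_cast; ring, by push_cast; ring⟩

theorem left_unique (h : D.IsLift u v p q) (h' : D.IsLift u v p' q) : p = p' := by
  obtain ⟨-, -, m, rfl, hq⟩ := h
  obtain ⟨-, -, m', rfl, hq'⟩ := h'
  linarith

theorem left_eq_of_int (hno : D.NoCrossing) (h : D.IsLift u v p q) (h' : D.IsLift u' v' p' q')
    (hr : rk u = rk u') (hp : ∃ m : ℤ, p = p' + m) : u = u' := by
  obtain ⟨-, -, m, rfl, -⟩ := h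
  obtain ⟨-, -, m', rfl, -⟩ := h'
  obtain ⟨k, hk⟩ := hp
  refine hno.1 ((D.point_eq_iff u u').2 ⟨⟨m' + k - m, ?_⟩, hr⟩)
  push_cast; linarith

theorem exists_int (h : D.IsLift u v p q) (h' : D.IsLift u v' p' q') : ∃ m : ℤ, p' = p + m := by
  obtain ⟨-, -, m, rfl, -⟩ := h
  obtain ⟨-, -, m', rfl, -⟩ := h'
  exact ⟨m' - m, by push_cast; ring⟩

/-- Lifts of arcs do not cross. -/
theorem mono (hno : D.NoCrossing) (h : D.IsLift u v p q) (h' : D.IsLift u' v' p' q')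
    (hr : rk u = rk u') (hq : q < q') : p ≤ p' := by
  by_contra! hp
  obtain ⟨ha, hv, m, hm, hm'⟩ := h
  obtain ⟨ha', hv', n, hn, hn'⟩ := h'
  -- The height above `rk u` at which the two segments would cross. It lies strictly between 0 and
  -- 1, so the crossing is not a vertex of the drawing.
  set θ := (p - p') / ((p - p') + (q' - q)) with hθ
  have hden : 0 < (p - p') + (q' - q) := by linarith
  have h0 : 0 < θ := by apply div_pos <;> linarith
  have h1 : θ < 1 := by rw [hθ, div_lt_one hden]; linarith
  have heq : p + θ * (q - p) = p' + θ * (q' - p') := by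
    have : θ * ((p - p') + (q' - q)) = p - p' := by rw [hθ]; field_simp
    linarith
  have hz : toCylinder (p + θ * (q - p), rk u + θ) ∈ D.arc u v := by
    rw [mem_arc_iff]
    refine ⟨θ, h0.le, h1.le, ?_⟩
    rw [toCylinder_eq_iff]
    refine ⟨⟨m, ?_⟩, ?_⟩
    · rw [hm, hm']; ring
    · rw [hv]; push_cast; ring
  have hz' : toCylinder (p + θ * (q - p), rk u + θ) ∈ D.arc u' v' := by
    rw [mem_arc_iff]
    refine ⟨θ, h0.le, h1.le, ?_⟩
    rw [toCylinder_eq_iff]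
    refine ⟨⟨n, ?_⟩, ?_⟩
    · rw [heq, hn, hn']; ring
    · rw [hv', hr]; push_cast; ring
  by_cases hs : s(u, v) = s(u', v')
  -- Two lifts of the same arc are translates of each other and so do not cross; the reversed edge
  -- is excluded by the ranks.
  · rcases Sym2.eq_iff.1 hs with ⟨rfl, rfl⟩ | ⟨rfl, rfl⟩
    · linarith
    · omega
  · obtain ⟨w, -, -, hw⟩ := hno.2 u v u' v' ha ha' hs _ ⟨hz, hz'⟩
    obtain ⟨-, hw⟩ := (toCylinder_eq_iff _ _).1 hw
    simp only at hw
    have a1 : rk u < rk w := by exact_mod_cast (by linarith : (rk u : ℝ) < rk w)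
    have a2 : rk w < rk u + 1 := by exact_mod_cast (by linarith : (rk w : ℝ) < rk u + 1)
    omega

end IsLift

end CylinderDrawing

/-- The lifts of finitely many points of a circle of length one, in increasing order. -/
theorem exists_sorted_lifts {n : ℕ} (hn : 0 < n) (y : Fin n → ℝ)
    (hy : ∀ i j, (∃ m : ℤ, y i = y j + m) → i = j) :
    ∃ (e : ℤ → Fin n) (q : ℤ → ℝ), StrictMono q ∧ (∀ j, q (j + n) = q j + 1) ∧
      (∀ j, e (j + n) = e j) ∧ (∀ j, ∃ m : ℤ, q j = y (e j) + m) ∧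
      ∀ i (m : ℤ), ∃ j, e j = i ∧ q j = y i + m := by
  have hn' : (0 : ℤ) < n := by exact_mod_cast hn
  set z : Fin n → ℝ := fun i => Int.fract (y i) with hz
  have hzinj : Function.Injective z := by
    intro i j h
    obtain ⟨m, hm⟩ := Int.fract_eq_fract.1 h
    exact hy i j ⟨m, by linarith⟩
  set σ := Tuple.sort z
  have hσ : StrictMono (z ∘ σ) :=
    (Tuple.monotone_sort z).strictMono_of_injective (hzinj.comp σ.injective)
  have hlt : ∀ j : ℤ, (j % n).toNat < n := fun j => by
    have := Int.emod_nonneg j hn'.ne'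
    have := Int.emod_lt_of_pos j hn'
    omega
  -- The residue of `j` is a position in the order of the fractional parts, and the quotient `j / n`
  -- is the integer shift.
  set e : ℤ → Fin n := fun j => σ ⟨(j % n).toNat, hlt j⟩ with he
  set q : ℤ → ℝ := fun j => z (e j) + (j / n : ℤ) with hq
  refine ⟨e, q, ?_, ?_, ?_, ?_, ?_⟩
  · refine strictMono_int_of_lt_succ fun j => ?_
    have h1 := Int.emod_nonneg j hn'.ne'
    have h2 := Int.emod_lt_of_pos j hn'
    have h3 := Int.mul_ediv_add_emod j n
    have hf0 : ∀ i, 0 ≤ z i := fun i => Int.fract_nonneg _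
    have hf1 : ∀ i, z i < 1 := fun i => Int.fract_lt_one _
    by_cases hc : j % n + 1 < n
    · have hm : (j + 1) % n = j % n + 1 := by
        rw [← Int.emod_eq_of_lt (by omega) hc, Int.emod_add_emod]
      have hd : (j + 1) / n = j / n := by
        have h4 := Int.mul_ediv_add_emod (j + 1) n
        have : (n : ℤ) * ((j + 1) / n) = n * (j / n) := by omega
        exact mul_left_cancel₀ hn'.ne' this
      have : z (e j) < z (e (j + 1)) := hσ (by
        rw [Fin.lt_def]
        simp only [hm]
        omega)
      simp only [hq, hd]
      linarith
    · have hd : (j + 1) / n = j / n + 1 := by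
        have : j + 1 = 0 + (j / n + 1) * n := by linarith [mul_comm (n : ℤ) (j / n)]
        rw [this, Int.add_mul_ediv_right _ _ hn'.ne']
        simp
      simp only [hq, hd]
      push_cast
      linarith [hf0 (e (j + 1)), hf1 (e j)]
  · intro j
    have hd : (j + n) / n = j / n + 1 := by
      simpa using Int.add_mul_ediv_right j 1 hn'.ne'
    simp only [hq, he, Int.add_emod_right, hd]
    push_cast; ring
  · intro j
    simp only [he, Int.add_emod_right]
  · intro j
    refine ⟨(j / n : ℤ) - ⌊y (e j)⌋, ?_⟩
    simp only [hq, hz, Int.fract]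
    push_cast; ring
  · intro i m
    set k := σ.symm i with hk
    have hkn := k.isLt
    have hm : ((k : ℤ) + (⌊y i⌋ + m) * n) % n = k := by
      rw [Int.add_mul_emod_self_right, Int.emod_eq_of_lt] <;> omega
    have hd : ((k : ℤ) + (⌊y i⌋ + m) * n) / n = ⌊y i⌋ + m := by
      rw [Int.add_mul_ediv_right _ _ hn'.ne', Int.ediv_eq_zero_of_lt] <;> omega
    have hei : e (k + (⌊y i⌋ + m) * n) = i := by
      have : (⟨_, hlt (k + (⌊y i⌋ + m) * n)⟩ : Fin n) = k := Fin.ext (by simp only [hm]; rfl)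
      simp only [he, this]
      exact σ.apply_symm_apply i
    refine ⟨k + (⌊y i⌋ + m) * n, hei, ?_⟩
    simp only [hq, hei, hd, hz, Int.fract]
    push_cast; ring

/-! ### Cyclic sequences of edges -/

/-- The edges `i` and `i'` share the vertex `v` and a face. -/
def EdgeStep (i : Fin 15) (v : Fin 7) (i' : Fin 15) : Prop :=
  i ≠ i' ∧ v ∈ fanoEdge i ∧ v ∈ fanoEdge i' ∧ ∃ f, EdgeOn i f ∧ EdgeOn i' f

instance (i : Fin 15) (v : Fin 7) (i' : Fin 15) : Decidable (EdgeStep i v i') := by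
  unfold EdgeStep; infer_instance

/-- The pairs `(v, i')` with `EdgeStep i v i'`, for each `i`. -/
def edgeSteps : List (List (ℕ × ℕ)) :=
  [[(1, 5), (1, 6), (2, 11), (2, 14)], [(2, 11), (2, 12), (3, 2), (3, 8)],
    [(3, 1), (3, 8), (4, 7), (4, 12)], [(4, 7), (4, 13), (6, 4), (6, 10)],
    [(6, 3), (6, 10), (5, 9), (5, 13)], [(5, 9), (5, 14), (1, 0), (1, 6)],
    [(1, 0), (1, 5), (0, 9), (0, 11)], [(0, 8), (0, 10), (4, 2), (4, 3)],
    [(3, 1), (3, 2), (0, 7), (0, 11)], [(0, 6), (0, 10), (5, 4), (5, 5)],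
    [(6, 3), (6, 4), (0, 7), (0, 9)], [(0, 6), (0, 8), (2, 0), (2, 1)],
    [(2, 1), (2, 14), (4, 2), (4, 13)], [(4, 3), (4, 12), (5, 4), (5, 14)],
    [(5, 5), (5, 13), (2, 0), (2, 12)]]

theorem mem_edgeSteps {i : Fin 15} {v : Fin 7} {i' : Fin 15} (h : EdgeStep i v i') :
    (v.val, i'.val) ∈ edgeSteps.getD i [] := by
  revert i v i'; decide +kernel

/-- Search for a cyclic sequence of edges that starts and ends at the edge `0` and leaves it through
the vertex `u₀`. The bit masks `E` and `U` collect the edges and the vertices that have occurred, `u`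
and `e` are the last of them, and `k + 1` is the number of steps that remain. A vertex may recur only
without interruption, except for `u₀`. -/
def searchCycle (u₀ : ℕ) : ℕ → ℕ → ℕ → ℕ → ℕ → Bool
  | 0, _, U, u, e => (edgeSteps.getD e []).any fun s =>
      s.2 == 0 && (s.1 == u || (s.1 == u₀ || !U.testBit s.1))
  | k + 1, E, U, u, e => (edgeSteps.getD e []).any fun s =>
      !E.testBit s.2 && ((s.1 == u || (s.1 == u₀ || !U.testBit s.1)) &&
        searchCycle u₀ k (E ||| 2 ^ s.2) (U ||| 2 ^ s.1) s.1 s.2)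

theorem searchCycle_eq_false :
    ∀ s ∈ edgeSteps.getD 0 [], searchCycle s.1 13 (2 ^ 0 ||| 2 ^ s.2) 0 s.1 s.2 = false := by
  decide +kernel

/-- An actual sequence is a successful branch of the search. For this the masks need only contain
nothing that has not occurred, since a bit that is set can only forbid a step. -/
theorem searchCycle_eq_true {e : ℕ → Fin 15} {u : ℕ → Fin 7}
    (hstep : ∀ n < 15, EdgeStep (e n) (u n) (e (n + 1)))
    (hinj : ∀ m n, m < n → n < 15 → e m ≠ e n) (hclose : e 15 = 0)
    (hcont : ∀ m n, m < n → n < 15 → u m = u n → u n = u (n - 1) ∨ u n = u 0) (k : ℕ) :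
    ∀ n E U, n + k = 14 → 0 < n → (∀ i, E.testBit i = true → ∃ m ≤ n, (e m).val = i) →
      (∀ i, U.testBit i = true → ∃ m < n, (u m).val = i) →
      searchCycle (u 0) k E U (u (n - 1)) (e n) = true := by
  have hfresh : ∀ n < 15, ∀ U : ℕ, (∀ i, U.testBit i = true → ∃ m < n, (u m).val = i) →
      ((u n).val == (u (n - 1)).val || ((u n).val == (u 0).val || !U.testBit (u n).val)) = true := by
    intro n hn U hU
    rw [Bool.or_eq_true, Bool.or_eq_true, beq_iff_eq, beq_iff_eq, Bool.not_eq_true']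
    by_contra! hc
    obtain ⟨m, hm, he⟩ := hU _ (by simpa using hc.2.2)
    rcases hcont m n hm hn (Fin.ext he) with h | h
    · exact hc.1 (congrArg _ h)
    · exact hc.2.1 (congrArg _ h)
  induction k with
  | zero =>
    intro n E U hn _ _ hU
    obtain rfl : n = 14 := by omega
    rw [searchCycle, List.any_eq_true]
    refine ⟨_, mem_edgeSteps (hstep 14 (by omega)), ?_⟩
    rw [Bool.and_eq_true]
    exact ⟨by simp [hclose], hfresh 14 (by omega) U hU⟩
  | succ k ih =>
    intro n E U hn hn0 hE hU
    rw [searchCycle, List.any_eq_true]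
    refine ⟨_, mem_edgeSteps (hstep n (by omega)), ?_⟩
    rw [Bool.and_eq_true, Bool.and_eq_true]
    refine ⟨?_, hfresh n (by omega) U hU, ?_⟩
    · rw [Bool.not_eq_true', ← Bool.not_eq_true]
      intro h
      obtain ⟨m, hm, he⟩ := hE _ h
      exact hinj m (n + 1) (by omega) (by omega) (Fin.ext he)
    · refine ih (n + 1) _ _ (by omega) (by omega) ?_ ?_
      · intro i hi
        rw [Nat.testBit_or, Bool.or_eq_true] at hi
        rcases hi with hi | hi
        · obtain ⟨m, hm, he⟩ := hE i hi
          exact ⟨m, by omega, he⟩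
        · rw [Nat.testBit_two_pow, decide_eq_true_eq] at hi
          exact ⟨n + 1, le_rfl, hi⟩
      · intro i hi
        rw [Nat.testBit_or, Bool.or_eq_true] at hi
        rcases hi with hi | hi
        · obtain ⟨m, hm, he⟩ := hU i hi
          exact ⟨m, by omega, he⟩
        · rw [Nat.testBit_two_pow, decide_eq_true_eq] at hi
          exact ⟨n, by omega, hi⟩

/-- There is no cyclic sequence of all the edges, consecutive ones sharing a vertex and a face, in
which the shared vertices are grouped together. -/
theorem no_cyclic_sequence {e : ℕ → Fin 15} {u : ℕ → Fin 7}
    (hstep : ∀ n < 15, EdgeStep (e n) (u n) (e (n + 1)))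
    (hinj : ∀ m n, m < n → n < 15 → e m ≠ e n) (hopen : e 0 = 0) (hclose : e 15 = 0)
    (hcont : ∀ m n, m < n → n < 15 → u m = u n → u n = u (n - 1) ∨ u n = u 0) : False := by
  -- The search begins after the first step, with the edges `e 0 = 0` and `e 1` used. The vertex
  -- mask is empty because `u 0` is always allowed.
  have h := searchCycle_eq_true hstep hinj hclose hcont 13 1 (2 ^ 0 ||| 2 ^ (e 1).val) 0 rfl one_pos
    (fun i hi => by
      rw [Nat.testBit_or, Bool.or_eq_true, Nat.testBit_two_pow, Nat.testBit_two_pow,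
        decide_eq_true_eq, decide_eq_true_eq] at hi
      rcases hi with rfl | hi
      · exact ⟨0, zero_le_one, by rw [hopen]; rfl⟩
      · exact ⟨1, le_rfl, hi⟩) (by simp)
  have h0 := mem_edgeSteps (hstep 0 (by omega))
  rw [hopen] at h0
  rw [Nat.sub_self, searchCycle_eq_false _ h0] at h
  exact Bool.false_ne_true h

/-! ### The cell lattice has no rhombic strip -/

open StraightLineGraph

/-- The `i`-th edge as a cell. -/
def edgeCell (i : Fin 15) : fano.Cell := Cell.edge ⟨fanoEdge i, fanoEdge_mem i⟩

theorem edgeCell_injective : Function.Injective edgeCell := by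
  intro i j h
  simp only [edgeCell, Cell.edge.injEq, Subtype.mk.injEq] at h
  exact fanoEdge_injective h

theorem exists_edgeCell {c : fano.Cell} (h : c.dim = 1) : ∃ i, c = edgeCell i := by
  cases c with
  | edge e =>
    obtain ⟨e, he⟩ := e
    obtain ⟨i, rfl⟩ := (mem_edgeSet_iff e).1 he
    exact ⟨i, rfl⟩
  | _ => simp [Cell.dim] at h

theorem exists_vertexCell {c : fano.Cell} (h : c.dim = 0) : ∃ v, c = Cell.vertex v := by
  cases c with
  | vertex v => exact ⟨v, rfl⟩
  | _ => simp [Cell.dim] at h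

theorem exists_faceCell {c : fano.Cell} (h : c.dim = 2) : ∃ i, c = Cell.face (fanoFace i) := by
  cases c with
  | face F =>
    obtain ⟨i, rfl⟩ := fanoFace_surjective F
    exact ⟨i, rfl⟩
  | _ => simp [Cell.dim] at h

theorem mem_of_vertex_lt_edgeCell {v : Fin 7} {i : Fin 15}
    (h : (Cell.vertex v : fano.Cell) < edgeCell i) : v ∈ fanoEdge i :=
  vertex_mem_fanoEdge_of_mem_segment ((Cell.dim_lt_of_lt h).2 rfl)

theorem edgeOn_of_edgeCell_lt {i : Fin 15} {f : Fin 10}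
    (h : edgeCell i < (Cell.face (fanoFace f) : fano.Cell)) : EdgeOn i f := by
  rw [← edgeOn_iff, ← closure_region]
  exact (Cell.dim_lt_of_lt h).2

theorem not_hasRhombicStrip : ¬ HasRhombicStrip (Cell.dim : fano.Cell → ℤ) := by
  rintro ⟨R, hRle, D, hno, hface⟩
  have hcov : ∀ a b, R.Adj a b → a ⋖ b ∨ b ⋖ a := fun a b h =>
    (SimpleGraph.hasse_adj).1 (hRle h)
  have hR : ∀ a b, R.Adj a b → b.dim = a.dim + 1 ∨ a.dim = b.dim + 1 := fun a b h =>
    (hcov a b h).imp (fano_isRankFunction a b) (fano_isRankFunction b a)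
  have hlt : ∀ a b, R.Adj a b → a.dim < b.dim → a < b := by
    intro a b h hd
    rcases hcov a b h with h | h
    · exact h.lt
    · exact absurd hd (Cell.dim_lt_of_lt h.lt).1.asymm
  obtain ⟨e, q, hqmono, hqper, heper, hqlift, hsurj⟩ :=
    exists_sorted_lifts (n := 15) (by norm_num) (fun i => D.x (edgeCell i))
      (fun i j h => edgeCell_injective (hno.1 ((D.point_eq_iff _ _).2 ⟨h, rfl⟩)))
  simp only [Nat.cast_ofNat] at hqper heper
  have hinj : ∀ j k, j < k → k < j + 15 → e j ≠ e k := by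
    intro j k hjk hk he
    obtain ⟨m, hm⟩ := hqlift j
    obtain ⟨n, hn⟩ := hqlift k
    rw [← he] at hn
    have h1 := hqmono hjk
    have h2 := hqmono hk
    rw [hqper] at h2
    have a1 : m < n := by exact_mod_cast (by linarith : (m : ℝ) < n)
    have a2 : n < m + 1 := by exact_mod_cast (by linarith : (n : ℝ) < m + 1)
    omega
  have hrhombus : ∀ j, ∃ v, R.Adj (Cell.vertex v) (edgeCell (e j)) ∧
      R.Adj (Cell.vertex v) (edgeCell (e (j + 1))) ∧ EdgeStep (e j) v (e (j + 1)) := by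
    intro j
    have hne := hinj j (j + 1) (by omega) (by omega)
    obtain ⟨lo, hi, h1, h2, h3, h4, h5, h6⟩ := CylinderDrawing.exists_rhombus_of_gap hR hno hface
      (edgeCell_injective.ne hne) rfl (hqlift j) (hqlift (j + 1)) (hqmono (by omega))
      (fun c k hc hk => by
        obtain ⟨i, rfl⟩ := exists_edgeCell hc
        obtain ⟨j', -, hj'⟩ := hsurj i k
        rw [← hj'] at hk ⊢
        exact hqmono.monotone (Int.add_one_le_iff.2 (hqmono.lt_iff_lt.1 hk)))
    obtain ⟨v, rfl⟩ := exists_vertexCell h1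
    obtain ⟨f, rfl⟩ := exists_faceCell h2
    refine ⟨v, h3, h4, hne, mem_of_vertex_lt_edgeCell (hlt _ _ h3 zero_lt_one),
      mem_of_vertex_lt_edgeCell (hlt _ _ h4 zero_lt_one), f,
      edgeOn_of_edgeCell_lt (hlt _ _ h5 one_lt_two),
      edgeOn_of_edgeCell_lt (hlt _ _ h6 one_lt_two)⟩
  choose u hu hu' hstep using hrhombus
  have hlifts : ∀ j, ∃ p, D.IsLift (Cell.vertex (u j)) (edgeCell (e j)) p (q j) ∧
      D.IsLift (Cell.vertex (u j)) (edgeCell (e (j + 1))) p (q (j + 1)) := by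
    intro j
    obtain ⟨p, hp⟩ := CylinderDrawing.IsLift.exists_of_adj (hu j) rfl (hqlift j)
    obtain ⟨p', hp'⟩ := CylinderDrawing.IsLift.exists_of_adj (hu' j) rfl (hqlift (j + 1))
    -- Both arcs start at lifts of the same vertex, so `p' - p` is an integer, and monotonicity
    -- leaves only 0 and 1.
    have h1 : p ≤ p' := hp.mono hno hp' rfl (hqmono (by omega))
    have h2 : p' ≤ p + 1 := hp'.mono hno hp.add_one rfl (by
      rw [← hqper]; exact hqmono (by omega))
    obtain ⟨m, rfl⟩ := hp.exists_int hp'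
    have m0 : 0 ≤ m := by exact_mod_cast (by linarith : (0 : ℝ) ≤ m)
    have m1 : m ≤ 1 := by exact_mod_cast (by linarith : (m : ℝ) ≤ 1)
    obtain rfl | rfl : m = 0 ∨ m = 1 := by omega
    · exact ⟨p, hp, by simpa using hp'⟩
    -- If the difference were 1, every arc rising to an edge strictly between positions `j + 1` and
    -- `j + 15` would be squeezed to start at `p + 1`, hence at `u j`. An edge not incident with `u
    -- j` gives the contradiction.
    · exfalso
      have hmiss : ∀ v, ∃ i, v ∉ fanoEdge i := by decide +kernel
      obtain ⟨i, hi⟩ := hmiss (u j)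
      -- This integer selects the lift of the edge `i` in the interval from `q j` (excluded) to `q j
      -- + 1` (included).
      obtain ⟨j', rfl, hj'⟩ := hsurj i (⌊q j - D.x (edgeCell i)⌋ + 1)
      push_cast at hj'
      have b1 : j < j' := hqmono.lt_iff_lt.1 (by
        linarith [Int.lt_floor_add_one (q j - D.x (edgeCell (e j')))])
      have b2 : j' ≤ j + 15 := hqmono.le_iff_le.1 (by
        rw [hqper]
        linarith [Int.floor_le (q j - D.x (edgeCell (e j')))])
      have b3 : j' ≠ j + 15 := by
        rintro rfl
        rw [heper] at hi
        exact hi (hstep j).2.1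
      have b4 : j' ≠ j + 1 := by
        rintro rfl
        exact hi (hstep j).2.2.1
      obtain ⟨r, hr⟩ := CylinderDrawing.IsLift.exists_of_adj (hu j') rfl (hqlift j')
      have c1 := hp'.mono hno hr rfl (hqmono (by omega))
      have c2 := hr.mono hno hp.add_one rfl (by rw [← hqper]; exact hqmono (by omega))
      have c3 := hr.left_eq_of_int hno hp rfl ⟨1, le_antisymm (by simpa using c2) c1⟩
      simp only [Cell.vertex.injEq] at c3
      rw [← c3] at hi
      exact hi (hstep j').2.1
  choose p hp hp' using hlifts
  have hpmono : Monotone p := monotone_int_of_le_succ fun j =>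
    (hp j).mono hno (hp' (j + 1)) rfl (hqmono (by omega))
  have huper : ∀ j, u (j + 15) = u j := by
    intro j
    have h1 := hstep j
    have h2 := hstep (j + 15)
    rw [show j + 15 + 1 = j + 1 + 15 by ring, heper, heper] at h2
    -- Distinct edges have at most one common vertex, so the periodicity of `e` passes to `u`.
    have : ∀ i i' v v', EdgeStep i v i' → EdgeStep i v' i' → v' = v := by decide +kernel
    exact this _ _ _ _ h1 h2
  have hpper : ∀ j, p (j + 15) = p j + 1 := by
    intro j
    have h := hp (j + 15)
    rw [huper, heper, hqper] at h
    exact h.left_unique (hp j).add_one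
  have hpu : ∀ a b, p a = p b → u a = u b := by
    intro a b h
    have := (hp a).left_eq_of_int hno (hp b) rfl ⟨0, by simpa using h⟩
    simpa using this
  -- The period is started at the edge `0`, where the search starts.
  obtain ⟨j₀, hj₀, -⟩ := hsurj 0 0
  have hcont : ∀ a b, j₀ ≤ a → a < b → b < j₀ + 15 → u a = u b → u b = u (b - 1) ∨ u b = u j₀ := by
    intro a b ha hab hb heq
    obtain ⟨m, hm⟩ : ∃ m : ℤ, p b = p a + m := by
      have h := hp b
      rw [← heq] at h
      exact (hp a).exists_int h
    have h1 := hpmono hab.le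
    have h2 := hpmono (show b ≤ a + 15 by omega)
    rw [hpper] at h2
    have m0 : 0 ≤ m := by exact_mod_cast (by linarith : (0 : ℝ) ≤ m)
    have m1 : m ≤ 1 := by exact_mod_cast (by linarith : (m : ℝ) ≤ 1)
    obtain rfl | rfl : m = 0 ∨ m = 1 := by omega
    -- The lift is the same at `a` and `b`, so the monotone `p` is constant in between.
    · left
      apply hpu
      have h3 := hpmono (show a ≤ b - 1 by omega)
      have h4 := hpmono (show b - 1 ≤ b by omega)
      push_cast at hm
      linarith
    -- The lift at `b` is one turn further. Since `p j₀ ≤ p a` and `p b ≤ p j₀ + 1`, this forces `p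
    -- a = p j₀`: the block of `u j₀` is the one cut in two by the start of the period.
    · right
      rw [← heq]
      apply hpu
      have h3 := hpmono ha
      have h4 := hpmono hb.le
      rw [hpper] at h4
      push_cast at hm
      linarith
  refine no_cyclic_sequence (e := fun n => e (j₀ + n)) (u := fun n => u (j₀ + n)) ?_ ?_ ?_ ?_ ?_
  · intro n _
    have := hstep (j₀ + n)
    rwa [add_assoc] at this
  · intro m n hmn hn
    exact hinj _ _ (by omega) (by omega)
  · simpa using hj₀
  · simpa [heper] using hj₀
  · intro m n hmn hn h
    have := hcont (j₀ + m) (j₀ + n) (by omega) (by omega) (by omega) h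
    simpa [Nat.cast_sub (show 1 ≤ n by omega), add_sub_assoc] using this

theorem proposition7p5 :
    -- `H = fano` is a 3-connected plane graph (on the vertex set `Fin 7`)
    fano.IsPlane ∧ ThreeConnected fano.graph ∧
    -- `H` and its dual graph have a Hamiltonian cycle
    HasHamiltonianCycle fano.graph ∧ HasHamiltonianCycle fano.dual ∧
    -- `L(H)` is graded by the dimension, and its cover graph has no rhombic strip
    IsRankFunction (StraightLineGraph.Cell.dim : fano.Cell → ℤ) ∧
    ¬ HasRhombicStrip (StraightLineGraph.Cell.dim : fano.Cell → ℤ) ∧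
    -- up to symmetry, `H` has exactly two Hamiltonian cycles, and both violate the chord condition
    (∃ C₁ C₂ : fano.graph.Walk 0 0,
      C₁.support = [0, 1, 2, 3, 4, 5, 6, 0] ∧ C₂.support = [0, 5, 1, 2, 3, 4, 6, 0] ∧
      C₁.IsHamiltonianCycle ∧ C₂.IsHamiltonianCycle ∧ ¬ EquivCycles C₁ C₂ ∧
      ¬ ChordCondition C₁ ∧ ¬ ChordCondition C₂ ∧
      ∀ (v : Fin 7) (C : fano.graph.Walk v v), C.IsHamiltonianCycle →
        (EquivCycles C C₁ ∨ EquivCycles C C₂) ∧ ¬ ChordCondition C) := by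
  obtain ⟨C₁, h₁, hC₁⟩ := exists_hamiltonianCycle (G := fano.graph) 0 [1, 2, 3, 4, 5, 6]
    (by decide +kernel) (by decide) (by decide) (by decide)
  obtain ⟨C₂, h₂, hC₂⟩ := exists_hamiltonianCycle (G := fano.graph) 0 [5, 1, 2, 3, 4, 6]
    (by decide +kernel) (by decide) (by decide) (by decide)
  exact ⟨fano_isPlane, fano_threeConnected, fano_hasHamiltonianCycle,
    fano_hasHamiltonianCycle_dual, fano_isRankFunction, not_hasRhombicStrip, C₁, C₂, h₁, h₂, hC₁,
    hC₂, not_equivCycles h₁ h₂, (hamiltonianCycle_classification hC₁ h₁ h₂).2,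
    (hamiltonianCycle_classification hC₂ h₁ h₂).2,
    fun _ _ hC => hamiltonianCycle_classification hC h₁ h₂⟩
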